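/- Let $(X,\|\cdot\|)$ be a (real or complex) Banach space and let $(T_t)_{t\ge 0}$ be a strongly continuous contraction semigroup on $X$ with generator $(L,\mathrm{Dom}(L))$. We say that a family $(G(t))_{t\ge0}$ of bounded linear operators on $X$ is *Chernoff equivalent* to a strongly continuous semigroup $(S_t)_{t\ge0}$ with generator $A$ if $G(0)=\mathrm{Id}$, there is $a\ge 0$ with $\|G(t)\|\le e^{at}$ for all $t\ge0$, and there is a linear subspace $D\subset\mathrm{Dom}(A)$ which is a core for $A$ such that $\lim_{t\searrow0}\big\|\frac{G(t)\varphi-\varphi}{t}-A\varphi\big\|=0$ for every $\varphi\in D$. Let $(F(t))_{t\ge0}$ be a family of linear contractions on $X$ which is Chernoff equivalent to $(T_t)_{t\ge0}$ and such that $t\mapsto F(t)\varphi$ is strongly measurable (for instance continuous) on $[0,\infty)$ for every $\varphi\in X$. Let $\sigma,\lambda\ge0$ be constants, let $\mu$ be a bounded Borel measure on $(0,\infty)$, and let $$f(x)=\sigma+\lambda x+\int_{(0,\infty)}(1-e^{-sx})\,\mu(ds)$$ be the Bernstein function with triplet $(\sigma,\lambda,\mu)$. Let $(\eta_t)_{t\ge0}$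 be the associated convolution semigroup supported by $[0,\infty)$, that is, Borel measures on $[0,\infty)$ with $\eta_t([0,\infty))\le1$, $\eta_s*\eta_t=\eta_{s+t}$, $\eta_0=\delta_0$, $\eta_t\to\delta_0$ weakly as $t\to0$, and $\int e^{-sx}\,\eta_t(ds)=e^{-tf(x)}$ for all $x>0$, $t>0$. Let $$T^f_t\varphi=\int_{[0,\infty)}T_s\varphi\,\eta_t(ds)\qquad(\varphi\in X,\ t\ge0)$$ (Bochner integral) be the family subordinate to $(T_t)_{t\ge0}$ with respect to $(\eta_t)_{t\ge0}$. Let $m:(0,\infty)\to\{0,1,2,\dots\}$ be nonincreasing with $m(t)\to\infty$ as $t\searrow0$. For $\varphi\in X$ put $\mathcal F_\mu(0)\varphi=\varphi$ and, for $t>0$, $$\mathcal F_\mu(t)\varphi=e^{-\sigma t}\,F(\lambda t)\Big(\varphi+t\int_{(0,\infty)}\big([F(s/m(t))]^{m(t)}\varphi-\varphi\big)\,\mu(ds)\Big),$$ where the zeroth power of an operator is the identity (so that the integrand is $0$ if $m(t)=0$). Then the Bochner integrals exist, $(T^f_t)_{t\ge0}$ is a strongly continuous contraction semigroup on $X$,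 the $\mathcal F_\mu(t)$ are bounded linear operators, and the family $(\mathcal F_\mu(t))_{t\ge0}$ is Chernoff equivalent to $(T^f_t)_{t\ge0}$. Moreover, for every $\varphi\in X$, $$T^f_t\varphi=\lim_{n\to\infty}\big[\mathcal F_\mu(t/n)\big]^n\varphi$$ locally uniformly with respect to $t\in[0,\infty)$. -/

import Mathlib

open Filter Topology MeasureTheory Set
open scoped NNReal

section Semigroups

variable {𝕜 X : Type*} [RCLike 𝕜] [NormedAddCommGroup X] [NormedSpace 𝕜 X]

/-- `(T t)` with `t ≥ 0` is a strongly continuous semigroup of bounded linear operators on `X`. -/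
structure IsStronglyContinuousSemigroup (T : ℝ≥0 → X →L[𝕜] X) : Prop where
  map_zero : T 0 = ContinuousLinearMap.id 𝕜 X
  map_add : ∀ s t : ℝ≥0, T (s + t) = (T s).comp (T t)
  tendsto_zero : ∀ φ : X, Tendsto (fun t : ℝ≥0 => T t φ) (𝓝 0) (𝓝 φ)

/-- A strongly continuous semigroup of contractions. -/
structure IsContractionSemigroup (T : ℝ≥0 → X →L[𝕜] X) : Prop
    extends IsStronglyContinuousSemigroup T where
  norm_le_one : ∀ t : ℝ≥0, ‖T t‖ ≤ 1

variable [NormedSpace ℝ X]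

/-- `φ` belongs to the domain of the derivative at the origin of the operator family `G` and this
derivative sends `φ` to `y`, that is, `(G t φ - G 0 φ) / t` tends to `y` as `t` decreases to `0`. -/
def HasDerivAtOrigin (G : ℝ≥0 → X →L[𝕜] X) (φ y : X) : Prop :=
  Tendsto (fun t : ℝ≥0 => (t : ℝ)⁻¹ • (G t φ - G 0 φ)) (𝓝[>] 0) (𝓝 y)

theorem nhdsGT_zero_nnreal_neBot : (𝓝[>] (0 : ℝ≥0)).NeBot := nhdsGT_neBot 0

theorem HasDerivAtOrigin.add {G : ℝ≥0 → X →L[𝕜] X} {φ ψ y z : X}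
    (h : HasDerivAtOrigin G φ y) (h' : HasDerivAtOrigin G ψ z) :
    HasDerivAtOrigin G (φ + ψ) (y + z) := by
  unfold HasDerivAtOrigin at *
  refine (Tendsto.add h h').congr fun t => ?_
  rw [map_add, map_add, ← smul_add]
  congr 1
  abel

theorem HasDerivAtOrigin.unique {G : ℝ≥0 → X →L[𝕜] X} {φ y z : X}
    (h : HasDerivAtOrigin G φ y) (h' : HasDerivAtOrigin G φ z) : y = z :=
  haveI := nhdsGT_zero_nnreal_neBot
  tendsto_nhds_unique h h'

variable [IsScalarTower ℝ 𝕜 X]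

theorem HasDerivAtOrigin.smul {G : ℝ≥0 → X →L[𝕜] X} {φ y : X} (c : 𝕜)
    (h : HasDerivAtOrigin G φ y) : HasDerivAtOrigin G (c • φ) (c • y) := by
  unfold HasDerivAtOrigin at *
  refine (Tendsto.const_smul h c).congr fun t => ?_
  rw [map_smul, map_smul, ← smul_sub, smul_comm]

/-- The infinitesimal generator of the operator semigroup `T`, as an unbounded operator:
`L φ = lim (T t φ - T 0 φ) / t` as `t` decreases to `0` (where `T 0` is the identity), on the
domain of all `φ` for which the limit exists. -/
noncomputable def semigroupGenerator (T : ℝ≥0 → X →L[𝕜] X) : X →ₗ.[𝕜] X where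
  domain :=
    { carrier := {φ | ∃ y, HasDerivAtOrigin T φ y}
      add_mem' := fun ⟨y, hy⟩ ⟨z, hz⟩ => ⟨y + z, hy.add hz⟩
      zero_mem' := ⟨0, by simp [HasDerivAtOrigin]⟩
      smul_mem' := fun c _ ⟨y, hy⟩ => ⟨c • y, hy.smul c⟩ }
  toFun :=
    { toFun := fun φ => Classical.choose φ.2
      map_add' := fun φ ψ => (Classical.choose_spec (φ + ψ).2).unique
        ((Classical.choose_spec φ.2).add (Classical.choose_spec ψ.2))
      map_smul' := fun c φ => (Classical.choose_spec (c • φ).2).unique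
        ((Classical.choose_spec φ.2).smul c) }

theorem semigroupGenerator_apply_eq_iff (T : ℝ≥0 → X →L[𝕜] X)
    (φ : (semigroupGenerator T).domain) (y : X) :
    semigroupGenerator T φ = y ↔ HasDerivAtOrigin T (φ : X) y :=
  ⟨fun h => h ▸ Classical.choose_spec φ.2, fun h => (Classical.choose_spec φ.2).unique h⟩

/-- The operator family `F` is Chernoff equivalent to the semigroup `T`: `F 0` is the identity,
`‖F t‖ ≤ exp (a t)` for some `a ≥ 0`, and there is a core `D` of the generator `L` of `T` such
that `(F t φ - φ) / t` tends to `L φ` as `t` decreases to `0`, for every `φ ∈ D`. -/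
def ChernoffEquivalent (F T : ℝ≥0 → X →L[𝕜] X) : Prop :=
  F 0 = ContinuousLinearMap.id 𝕜 X ∧
  (∃ a : ℝ, 0 ≤ a ∧ ∀ t : ℝ≥0, ‖F t‖ ≤ Real.exp (a * t)) ∧
  ∃ (D : Submodule 𝕜 X) (hD : (semigroupGenerator T).HasCore D),
    ∀ (φ : X) (hφ : φ ∈ D),
      Tendsto (fun t : ℝ≥0 => (t : ℝ)⁻¹ • (F t φ - φ)) (𝓝[>] 0)
        (𝓝 (semigroupGenerator T ⟨φ, hD.le_domain hφ⟩))

/-- A convolution semigroup `(η t)`, `t ≥ 0`, of sub-probability Borel measures supported by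
`[0, ∞)`; these are encoded as measures on `ℝ≥0`. The last condition is weak convergence of `η t`
to the Dirac measure at `0`. -/
structure IsConvolutionSemigroup (η : ℝ≥0 → Measure ℝ≥0) : Prop where
  mass_le_one : ∀ t, η t univ ≤ 1
  conv : ∀ s t, Measure.conv (η s) (η t) = η (s + t)
  zero : η 0 = Measure.dirac 0
  tendsto_zero : ∀ g : BoundedContinuousFunction ℝ≥0 ℝ,
    Tendsto (fun t : ℝ≥0 => ∫ s, g s ∂(η t)) (𝓝 0) (𝓝 (g 0))

/-- The Bernstein function with triplet `(σ, lam, μ)`, where `μ` is a measure on `(0, ∞)`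
(encoded as a measure on `ℝ≥0` without mass at `0`), evaluated at `x`. -/
noncomputable def bernsteinFunction (σ lam : ℝ≥0) (μ : Measure ℝ≥0) (x : ℝ) : ℝ :=
  σ + lam * x + ∫ s : ℝ≥0, (1 - Real.exp (-(s * x))) ∂μ

/-- The Laplace transform of `η t` is `exp (-t f)` for every `t > 0`. -/
def HasLaplaceExponent (η : ℝ≥0 → Measure ℝ≥0) (f : ℝ → ℝ) : Prop :=
  ∀ t : ℝ≥0, 0 < t → ∀ x : ℝ, 0 < x →
    ∫ s : ℝ≥0, Real.exp (-(s * x)) ∂(η t) = Real.exp (-(t * f x))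

/-- `S` is the family subordinate to `T` with respect to `η`: `S t φ` is the Bochner integral
`∫ T s φ (η t)(ds)`. -/
def IsSubordinate (T : ℝ≥0 → X →L[𝕜] X) (η : ℝ≥0 → Measure ℝ≥0)
    (S : ℝ≥0 → X →L[𝕜] X) : Prop :=
  ∀ (t : ℝ≥0) (φ : X), Integrable (fun s : ℝ≥0 => T s φ) (η t) ∧ S t φ = ∫ s, T s φ ∂(η t)

/-- `G` is the family of bounded linear operators
`G t φ = e^{-σ t} F(lam t) (φ + t ∫ (F(s / m t)^(m t) φ - φ) μ(ds))`, with a convergent Bochner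
integral. Where `m t = 0`, the power is the identity. -/
def IsLevyFamily (F : ℝ≥0 → X →L[𝕜] X) (σ lam : ℝ≥0) (μ : Measure ℝ≥0) (m : ℝ≥0 → ℕ)
    (G : ℝ≥0 → X →L[𝕜] X) : Prop :=
  ∀ (t : ℝ≥0) (φ : X),
    Integrable (fun s : ℝ≥0 => (F (s / (m t : ℝ≥0)) ^ m t) φ - φ) μ ∧
    G t φ = Real.exp (-(σ * t : ℝ)) •
      F (lam * t) (φ + (t : ℝ) • ∫ s : ℝ≥0, ((F (s / (m t : ℝ≥0)) ^ m t) φ - φ) ∂μ)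

end Semigroups

/-! Write |μ| for the total mass of μ. Since it is finite, the subordinate semigroup is explicit.
The map sending a measure α to ∫ T_s α(ds) turns convolution into composition, and uniqueness of
Laplace transforms identifies η_t with the compound Poisson law e^{-(σ+|μ|)t} ∑ (t^n/n!) δ_{λt} *
μ^{*n}. Hence T^f_t = e^{tC} T_{λt}, where C = ∫ T_s μ(ds) - σ - |μ| is bounded and commutes with T.
Its generator is the closure of λL + C on any core of L, and it is contractive because η_t has mass
at most 1.

On the core D supplied by the equivalence of F and T, the derivative of the Lévy family at 0 is λLφ
- σφ + lim ∫ (F(s/n)^n φ - φ) μ(ds). Chernoff's theorem for F and dominated convergence turn the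
last limit into ∫ (T_s φ - φ) μ(ds). The norm bound comes from 1 + 2|μ|t ≤ e^{2|μ|t}, and a second
use of Chernoff's theorem, now for the Lévy family, gives the product formula.

Chernoff's theorem is proved without resolvents. For (φ, y) in the graph of the generator of S, the
powers of both F(h) and S(h) satisfy f^n φ = φ + h ∑_{k<n} f^k y up to a defect that is small
uniformly for nh ≤ R; for F this holds uniformly on compact parts of the graph. A discrete Fubini
identity (`sum_chernoffDefect`) along the orbit of (φ, y) then shows that the time-integrated error
h ∑_{k<n} (F(h)^k φ - S(h)^k φ) vanishes, and by density it vanishes for every vector. Inserting y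
as that vector and subtracting the two integral equations makes F(h)^n φ - S(h)^n φ itself vanish,
again for all vectors by density. -/

section Chernoff

variable {𝕜 X : Type*} [RCLike 𝕜] [NormedAddCommGroup X] [NormedSpace 𝕜 X]

/-! ### Orbits of contraction semigroups and powers of exponentially bounded families -/

namespace IsStronglyContinuousSemigroup

variable {S : ℝ≥0 → X →L[𝕜] X}

theorem map_nsmul (hS : IsStronglyContinuousSemigroup S) (h : ℝ≥0) (n : ℕ) :
    S (n * h) = S h ^ n := by
  induction n with
  | zero => simp [hS.map_zero, ContinuousLinearMap.one_def]
  | succ n ih =>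
    rw [pow_succ, ← ih, Nat.cast_succ, add_mul, one_mul, hS.map_add]
    rfl

theorem commute (hS : IsStronglyContinuousSemigroup S) (s t : ℝ≥0) : Commute (S s) (S t) := by
  change (S s).comp (S t) = (S t).comp (S s)
  rw [← hS.map_add, ← hS.map_add, add_comm]

end IsStronglyContinuousSemigroup

namespace IsContractionSemigroup

variable {S : ℝ≥0 → X →L[𝕜] X}

theorem norm_le_exp (hS : IsContractionSemigroup S) (t : ℝ≥0) : ‖S t‖ ≤ Real.exp (0 * t) := by
  simpa using hS.norm_le_one t

theorem norm_apply_le (hS : IsContractionSemigroup S) (t : ℝ≥0) (φ : X) : ‖S t φ‖ ≤ ‖φ‖ := by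
  simpa using (S t).le_of_opNorm_le (hS.norm_le_one t) φ

theorem norm_pow_apply_le (hS : IsContractionSemigroup S) (t : ℝ≥0) (n : ℕ) (φ : X) :
    ‖(S t ^ n) φ‖ ≤ ‖φ‖ := by
  rw [← hS.map_nsmul]
  exact hS.norm_apply_le _ φ

theorem norm_sub_le (hS : IsContractionSemigroup S) {s t : ℝ≥0} (hst : s ≤ t) (φ : X) :
    ‖S t φ - S s φ‖ ≤ ‖S (t - s) φ - φ‖ := by
  obtain ⟨r, rfl⟩ := exists_add_of_le hst
  rw [add_tsub_cancel_left, hS.map_add, ContinuousLinearMap.comp_apply, ← map_sub]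
  exact hS.norm_apply_le _ _

theorem continuous_apply (hS : IsContractionSemigroup S) (φ : X) :
    Continuous fun t => S t φ := by
  rw [continuous_iff_continuousAt]
  intro t
  rw [ContinuousAt, tendsto_iff_norm_sub_tendsto_zero]
  have h1 : Tendsto (fun s : ℝ≥0 => (s - t) + (t - s)) (𝓝 t) (𝓝 0) := by
    have : Continuous fun s : ℝ≥0 => (s - t) + (t - s) := by fun_prop
    simpa using this.tendsto t
  have h2 := (tendsto_iff_norm_sub_tendsto_zero.1 (hS.tendsto_zero φ)).comp h1
  refine squeeze_zero (fun _ => norm_nonneg _) (fun s => ?_) h2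
  rcases le_total s t with h | h
  · rw [norm_sub_rev]
    simpa [tsub_eq_zero_of_le h] using hS.norm_sub_le h φ
  · simpa [tsub_eq_zero_of_le h] using hS.norm_sub_le h φ

end IsContractionSemigroup

theorem norm_pow_apply_le_exp {F : ℝ≥0 → X →L[𝕜] X} {a : ℝ} (ha : 0 ≤ a)
    (hF : ∀ t : ℝ≥0, ‖F t‖ ≤ Real.exp (a * t)) {h R : ℝ≥0} {n : ℕ} (hn : n * h ≤ R) (φ : X) :
    ‖(F h ^ n) φ‖ ≤ Real.exp (a * R) * ‖φ‖ := by
  have key : ∀ n : ℕ, ‖(F h ^ n) φ‖ ≤ Real.exp (a * h) ^ n * ‖φ‖ := by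
    intro n
    induction n with
    | zero => simp
    | succ n ih =>
      rw [pow_succ', mul_apply_eq_comp, pow_succ', mul_assoc]
      exact (F h).le_of_opNorm_le_of_le (hF h) ih
  refine (key n).trans ?_
  gcongr
  have : (n * h : ℝ) ≤ R := by exact_mod_cast hn
  rw [← Real.exp_nat_mul, Real.exp_le_exp, mul_left_comm]
  gcongr

theorem LinearPMap.HasCore.graph_subset_closure {A : X →ₗ.[𝕜] X} {D : Submodule 𝕜 X}
    (hD : A.HasCore D) : (A.graph : Set (X × X)) ⊆
      _root_.closure ((A.domRestrict D).graph : Set (X × X)) := by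
  by_cases hc : (A.domRestrict D).IsClosable
  · have := hc.graph_closure_eq_closure_graph
    rw [hD.closure_eq] at this
    rw [← this]
    rfl
  -- For a non-closable operator `closure` returns the operator itself, so here the restriction to
  -- `D` already equals `A`.
  · have := LinearPMap.closure_def' hc
    rw [hD.closure_eq] at this
    rw [← this]
    exact subset_closure

/-! ### The discrete integral equation and its defect -/

variable [NormedSpace ℝ X]

/-- The defect in the discrete integral equation `f ^ n φ = φ + h ∑_{k < n} f ^ k y` of an operator
`f` at `p = (φ, y)`. -/
noncomputable def chernoffDefect (f : X →L[𝕜] X) (h : ℝ≥0) (n : ℕ) (p : X × X) : X :=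
  (f ^ n) p.1 - p.1 - (h : ℝ) • ∑ k ∈ Finset.range n, (f ^ k) p.2

theorem chernoffDefect_sub (f : X →L[𝕜] X) (h : ℝ≥0) (n : ℕ) (p q : X × X) :
    chernoffDefect f h n (p - q) = chernoffDefect f h n p - chernoffDefect f h n q := by
  simp only [chernoffDefect, Prod.fst_sub, Prod.snd_sub, map_sub, Finset.sum_sub_distrib, smul_sub]
  abel

theorem norm_smul_sum_le {h R : ℝ≥0} {n : ℕ} (hn : n * h ≤ R) {v : ℕ → X} {C : ℝ} (hC : 0 ≤ C)
    (hv : ∀ k < n, ‖v k‖ ≤ C) : ‖(h : ℝ) • ∑ k ∈ Finset.range n, v k‖ ≤ R * C := by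
  have hn' : (n * h : ℝ) ≤ R := by exact_mod_cast hn
  rw [norm_smul, Real.norm_of_nonneg h.coe_nonneg]
  calc (h : ℝ) * ‖∑ k ∈ Finset.range n, v k‖ ≤ h * (n * C) := by
        gcongr
        refine (norm_sum_le_of_le _ fun k hk => hv k (Finset.mem_range.1 hk)).trans ?_
        simp
    _ = (n * h) * C := by ring
    _ ≤ R * C := by gcongr

theorem mul_le_of_le_nat {h R : ℝ≥0} {n k : ℕ} (hn : n * h ≤ R) (hk : k ≤ n) : k * h ≤ R :=
  le_trans (by gcongr) hn

theorem norm_chernoffDefect_le {F : ℝ≥0 → X →L[𝕜] X} {a : ℝ} (ha : 0 ≤ a)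
    (hF : ∀ t : ℝ≥0, ‖F t‖ ≤ Real.exp (a * t)) {h R : ℝ≥0} {n : ℕ} (hn : n * h ≤ R) (p : X × X) :
    ‖chernoffDefect (F h) h n p‖ ≤ (Real.exp (a * R) + 1 + R * Real.exp (a * R)) * ‖p‖ := by
  have h1 : ‖(F h ^ n) p.1‖ ≤ Real.exp (a * R) * ‖p‖ :=
    (norm_pow_apply_le_exp ha hF hn p.1).trans (by gcongr; exact norm_fst_le p)
  have h2 : ‖(h : ℝ) • ∑ k ∈ Finset.range n, (F h ^ k) p.2‖ ≤ R * (Real.exp (a * R) * ‖p‖) := by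
    refine norm_smul_sum_le hn (by positivity) fun k hk => ?_
    exact (norm_pow_apply_le_exp ha hF (mul_le_of_le_nat hn hk.le) p.2).trans
      (by gcongr; exact norm_snd_le p)
  have h3 := norm_fst_le p
  unfold chernoffDefect
  have h4 := norm_sub_le ((F h ^ n) p.1 - p.1) ((h : ℝ) • ∑ k ∈ Finset.range n, (F h ^ k) p.2)
  have h5 := norm_sub_le ((F h ^ n) p.1) p.1
  linarith

/-- Telescoping f^n φ - φ writes the defect as h ∑ f^k applied to the error of the difference
quotient at φ. That error tends to 0, and the weights h ∑ f^k are bounded for nh ≤ R. -/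
theorem eventually_norm_chernoffDefect_le_of_hasDerivAtOrigin {F : ℝ≥0 → X →L[𝕜] X} {a : ℝ}
    (ha : 0 ≤ a) (hF0 : F 0 = ContinuousLinearMap.id 𝕜 X)
    (hF : ∀ t : ℝ≥0, ‖F t‖ ≤ Real.exp (a * t)) {p : X × X} (hp : HasDerivAtOrigin F p.1 p.2)
    (R : ℝ≥0) {ε : ℝ} (hε : 0 < ε) :
    ∀ᶠ h in 𝓝[>] (0 : ℝ≥0), ∀ n : ℕ, n * h ≤ R → ‖chernoffDefect (F h) h n p‖ ≤ ε := by
  set M := Real.exp (a * R) with hM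
  have hM0 : 0 < M := Real.exp_pos _
  have hδ : 0 < ε / (R * M + 1) := by positivity
  filter_upwards [Metric.tendsto_nhds.1 hp _ hδ, self_mem_nhdsWithin] with h hh hpos n hn
  have hpos' : (h : ℝ) ≠ 0 := by exact_mod_cast (ne_of_gt hpos)
  have hid : chernoffDefect (F h) h n p = (h : ℝ) • ∑ k ∈ Finset.range n,
      (F h ^ k) ((h : ℝ)⁻¹ • (F h p.1 - F 0 p.1) - p.2) := by
    have h1 : (F h ^ n) p.1 - p.1 = ∑ k ∈ Finset.range n, (F h ^ k) (F h p.1 - F 0 p.1) := by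
      have : ∀ k, (F h ^ k) (F h p.1 - F 0 p.1) = (F h ^ (k + 1)) p.1 - (F h ^ k) p.1 := by
        intro k
        rw [map_sub, pow_succ, mul_apply_eq_comp, hF0]
        rfl
      simp_rw [this]
      rw [Finset.sum_range_sub fun k => (F h ^ k) p.1]
      simp
    have h2 : ∀ (L : X →L[𝕜] X) (v : X), L ((h : ℝ)⁻¹ • v) = (h : ℝ)⁻¹ • L v :=
      fun L v => map_real_smul L.toLinearMap.toAddMonoidHom L.continuous _ _
    have h3 : ∀ k, (F h ^ k) ((h : ℝ)⁻¹ • (F h p.1 - F 0 p.1) - p.2) =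
        (h : ℝ)⁻¹ • (F h ^ k) (F h p.1 - F 0 p.1) - (F h ^ k) p.2 := fun k => by rw [map_sub, h2]
    simp_rw [h3, Finset.sum_sub_distrib, ← Finset.smul_sum, smul_sub, smul_inv_smul₀ hpos', ← h1]
    rfl
  rw [hid]
  refine (norm_smul_sum_le hn (C := M * (ε / (R * M + 1))) (by positivity) fun k hk => ?_).trans ?_
  · refine (norm_pow_apply_le_exp ha hF (mul_le_of_le_nat hn hk.le) _).trans ?_
    gcongr
    rw [← dist_eq_norm]
    exact hh.le
  · rw [← mul_assoc, mul_div_assoc', div_le_iff₀ (by positivity)]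
    nlinarith

/-- The defect is additive in p with a bound independent of h and n while nh ≤ R. Smallness
therefore passes from the graph to its closure, and to a whole neighbourhood of each point of the
closure, as the compactness argument below requires. -/
theorem eventually_prod_norm_chernoffDefect_le {F : ℝ≥0 → X →L[𝕜] X} {a : ℝ}
    (ha : 0 ≤ a) (hF0 : F 0 = ContinuousLinearMap.id 𝕜 X)
    (hF : ∀ t : ℝ≥0, ‖F t‖ ≤ Real.exp (a * t)) {p : X × X}
    (hp : p ∈ closure {q : X × X | HasDerivAtOrigin F q.1 q.2})
    (R : ℝ≥0) {ε : ℝ} (hε : 0 < ε) :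
    ∀ᶠ z : (X × X) × ℝ≥0 in 𝓝 p ×ˢ 𝓝[>] (0 : ℝ≥0), ∀ n : ℕ, n * z.2 ≤ R →
      ‖chernoffDefect (F z.2) z.2 n z.1‖ ≤ ε := by
  set C := Real.exp (a * R) + 1 + R * Real.exp (a * R) with hC
  have hC0 : 0 < C := by positivity
  have hδ : 0 < ε / 2 / C / 2 := by positivity
  obtain ⟨q, hq, hpq⟩ := Metric.mem_closure_iff.1 hp _ hδ
  have h1 : ∀ᶠ r in 𝓝 p, dist r p < ε / 2 / C / 2 := Metric.ball_mem_nhds p hδ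
  have h2 := eventually_norm_chernoffDefect_le_of_hasDerivAtOrigin ha hF0 hF hq R (half_pos hε)
  filter_upwards [h1.prod_mk h2] with z hz n hn
  have h3 := norm_chernoffDefect_le ha hF hn (z.1 - q)
  rw [chernoffDefect_sub, ← hC] at h3
  have h4 : ‖z.1 - q‖ ≤ ε / 2 / C := by
    rw [← dist_eq_norm]
    linarith [dist_triangle z.1 p q, hz.1]
  have h5 : C * ‖z.1 - q‖ ≤ ε / 2 := by
    calc C * ‖z.1 - q‖ ≤ C * (ε / 2 / C) := by gcongr
      _ = ε / 2 := by field_simp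
  have h6 := norm_sub_norm_le (chernoffDefect (F z.2) z.2 n z.1) (chernoffDefect (F z.2) z.2 n q)
  linarith [hz.2 n hn]

theorem eventually_forall_norm_chernoffDefect_le {F : ℝ≥0 → X →L[𝕜] X} {a : ℝ}
    (ha : 0 ≤ a) (hF0 : F 0 = ContinuousLinearMap.id 𝕜 X)
    (hF : ∀ t : ℝ≥0, ‖F t‖ ≤ Real.exp (a * t)) {K : Set (X × X)} (hK : IsCompact K)
    (hKF : K ⊆ closure {q : X × X | HasDerivAtOrigin F q.1 q.2})
    (R : ℝ≥0) {ε : ℝ} (hε : 0 < ε) :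
    ∀ᶠ h in 𝓝[>] (0 : ℝ≥0), ∀ p ∈ K, ∀ n : ℕ, n * h ≤ R → ‖chernoffDefect (F h) h n p‖ ≤ ε := by
  have h1 : _ ∈ 𝓝ˢ K ×ˢ 𝓝[>] (0 : ℝ≥0) := hK.mem_nhdsSet_prod_of_forall fun p hp =>
    eventually_prod_norm_chernoffDefect_le ha hF0 hF (hKF hp) R hε
  obtain ⟨U, hU, V, hV, hUV⟩ := mem_prod_iff.1 h1
  filter_upwards [hV] with h hh p hp
  exact hUV (⟨subset_of_mem_nhdsSet hU hp, hh⟩ : (p, h) ∈ U ×ˢ V)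

/-- Both sides contain the same double sum h ∑ f^j s^k y over j + k < n. The mixed terms f^{n-k} s^k
φ run over 0 ≤ k < n on the left and over 0 < k ≤ n on the right, which leaves f^n φ - s^n φ. No
commutation of f and s is needed. -/
theorem sum_chernoffDefect (f s : X →L[𝕜] X) (h : ℝ≥0) (n : ℕ) (φ y : X) :
    ∑ k ∈ Finset.range n, chernoffDefect f h (n - k) ((s ^ k) φ, (s ^ k) y) =
      (f ^ n) φ - (s ^ n) φ + ∑ k ∈ Finset.range n, ((f ^ k) φ - (s ^ k) φ) +
        ∑ k ∈ Finset.range n, (f ^ k) (chernoffDefect s h (n - k) (φ, y)) := by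
  induction n generalizing φ y with
  | zero => simp
  | succ n ih =>
    -- Splitting off the first step of s shifts the base point to (s φ, s y), where the induction
    -- hypothesis applies.
    have hs : ∀ m, chernoffDefect s h (m + 1) (φ, y) =
        chernoffDefect s h m (s φ, s y) + (s φ - φ - (h : ℝ) • y) := by
      intro m
      simp only [chernoffDefect, Finset.sum_range_succ', smul_add, pow_succ,
        mul_apply_eq_comp, pow_zero, one_apply_eq_self]
      abel
    have h2 : ∀ (L : X →L[𝕜] X) (v : X), L ((h : ℝ) • v) = (h : ℝ) • L v :=
      fun L v => map_real_smul L.toLinearMap.toAddMonoidHom L.continuous _ _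
    have hsum : ∑ k ∈ Finset.range (n + 1), (f ^ k) (chernoffDefect s h (n + 1 - k) (φ, y)) =
        ∑ k ∈ Finset.range n, (f ^ k) (chernoffDefect s h (n - k) (s φ, s y)) +
          ∑ k ∈ Finset.range (n + 1), (f ^ k) (s φ - φ - (h : ℝ) • y) := by
      have : ∀ k ∈ Finset.range (n + 1), (f ^ k) (chernoffDefect s h (n + 1 - k) (φ, y)) =
          (f ^ k) (chernoffDefect s h (n - k) (s φ, s y)) +
          (f ^ k) (s φ - φ - (h : ℝ) • y) := by
        intro k hk
        rw [Nat.sub_add_comm (Finset.mem_range_succ_iff.1 hk), hs, map_add]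
      rw [Finset.sum_congr rfl this, Finset.sum_add_distrib,
        Finset.sum_range_succ (fun k => (f ^ k) (chernoffDefect s h (n - k) (s φ, s y)))]
      simp [chernoffDefect]
    rw [hsum, Finset.sum_range_succ']
    have hstep := ih (s φ) (s y)
    simp only [Nat.reduceSubDiff, pow_succ s, mul_apply_eq_comp] at hstep ⊢
    rw [hstep]
    have hss : ∑ k ∈ Finset.range n, (s ^ k) (s φ) + φ =
        ∑ k ∈ Finset.range n, (s ^ k) φ + (s ^ n) φ := by
      rw [← Finset.sum_range_succ, Finset.sum_range_succ']
      simp [pow_succ]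
    simp only [map_sub, h2, Finset.sum_sub_distrib, chernoffDefect, pow_zero,
      one_apply_eq_self, ← Finset.smul_sum] at hss ⊢
    have e1 := Finset.sum_range_succ (fun k => (f ^ k) (s φ)) n
    have e2 := Finset.sum_range_succ (fun k => (s ^ k) φ) n
    rw [e1, e2, ← hss]
    abel

theorem dist_pow_le_of_hasDerivAtOrigin {F S : ℝ≥0 → X →L[𝕜] X} {h : ℝ≥0} {n : ℕ} {φ y : X}
    {ε : ℝ} (hF : ‖chernoffDefect (F h) h n (φ, y)‖ ≤ ε)
    (hS : ‖chernoffDefect (S h) h n (φ, y)‖ ≤ ε)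
    (hFS : ‖(h : ℝ) • ∑ k ∈ Finset.range n, ((F h ^ k) y - (S h ^ k) y)‖ ≤ ε) :
    ‖(F h ^ n) φ - (S h ^ n) φ‖ ≤ 3 * ε := by
  have hid : (F h ^ n) φ - (S h ^ n) φ = chernoffDefect (F h) h n (φ, y) -
      chernoffDefect (S h) h n (φ, y) +
        (h : ℝ) • ∑ k ∈ Finset.range n, ((F h ^ k) y - (S h ^ k) y) := by
    simp only [chernoffDefect, Finset.sum_sub_distrib, smul_sub]
    abel
  rw [hid]
  refine (norm_add_le _ _).trans ?_
  linarith [norm_sub_le (chernoffDefect (F h) h n (φ, y)) (chernoffDefect (S h) h n (φ, y))]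

/-! ### The generator of a contraction semigroup is closed and densely defined -/

namespace IsContractionSemigroup

variable {S : ℝ≥0 → X →L[𝕜] X}

theorem hasDerivAtOrigin_apply (hS : IsContractionSemigroup S) {φ y : X}
    (h : HasDerivAtOrigin S φ y) (s : ℝ≥0) : HasDerivAtOrigin S (S s φ) (S s y) := by
  have h1 := ((S s).continuous.tendsto y).comp h
  refine h1.congr fun t => ?_
  have h2 : ∀ (L : X →L[𝕜] X) (r : ℝ) (v : X), L (r • v) = r • L v :=
    fun L r v => map_real_smul L.toLinearMap.toAddMonoidHom L.continuous _ _
  have h3 : ∀ r, S s (S r φ) = S r (S s φ) := fun r => congr($(hS.commute s r) φ)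
  simp only [Function.comp_apply, h2, map_sub, h3]

/-- If `(φ, y)` lies in the closure of the graph of the generator, then the difference quotient of
the orbit of `φ` is close to `y`. -/
theorem norm_sub_sub_smul_le (hS : IsContractionSemigroup S) {φ y : X}
    (hφ : (φ, y) ∈ closure {q : X × X | HasDerivAtOrigin S q.1 q.2}) {t : ℝ≥0} {ε : ℝ}
    (hε : 0 ≤ ε) (hy : ∀ s ≤ t, ‖S s y - y‖ ≤ ε) : ‖S t φ - φ - (t : ℝ) • y‖ ≤ t * ε := by
  refine le_of_forall_pos_le_add fun δ hδ => ?_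
  -- The defect estimate is applied to S itself with mesh t / (n + 1). The Riemann sum of S_s y
  -- differs from t y by at most t ε, and the defect is absorbed by δ.
  have h1 := eventually_forall_norm_chernoffDefect_le le_rfl hS.map_zero hS.norm_le_exp
    (isCompact_singleton (x := (φ, y))) (by simpa using hφ) t hδ
  rcases eq_or_ne t 0 with rfl | ht
  · simp [hS.map_zero, hδ.le]
  have h2 : Tendsto (fun n : ℕ => t / ((n : ℝ≥0) + 1)) atTop (𝓝[>] 0) := by
    refine tendsto_nhdsWithin_iff.2 ⟨?_, Eventually.of_forall fun n => ?_⟩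
    · simpa [div_eq_mul_inv] using (tendsto_one_div_add_atTop_nhds_zero_nat (𝕜 := ℝ≥0)).const_mul t
    · exact div_pos (pos_iff_ne_zero.2 ht) (by positivity)
  obtain ⟨n, hn⟩ := (h2.eventually h1).exists
  set h := t / ((n : ℝ≥0) + 1) with hh
  have hnh : ((n + 1 : ℕ) : ℝ≥0) * h = t := by
    rw [hh]; push_cast; field_simp
  have hd := hn _ rfl (n + 1) hnh.le
  have hs : ‖(h : ℝ) • ∑ k ∈ Finset.range (n + 1), ((S h ^ k) y - y)‖ ≤ t * ε := by
    refine norm_smul_sum_le hnh.le hε fun k hk => ?_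
    rw [← hS.map_nsmul]
    exact hy _ (mul_le_of_le_nat hnh.le hk.le)
  have hid : S t φ - φ - (t : ℝ) • y = chernoffDefect (S h) h (n + 1) (φ, y) +
      (h : ℝ) • ∑ k ∈ Finset.range (n + 1), ((S h ^ k) y - y) := by
    have hc : (t : ℝ) = h * ((n + 1 : ℕ) : ℝ) := by
      rw [← hnh]; push_cast; ring
    rw [chernoffDefect, ← hS.map_nsmul, hnh, hc, Finset.sum_sub_distrib, Finset.sum_const,
      Finset.card_range, smul_sub, mul_smul, Nat.cast_smul_eq_nsmul]
    abel
  rw [hid]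
  linarith [norm_add_le (chernoffDefect (S h) h (n + 1) (φ, y))
    ((h : ℝ) • ∑ k ∈ Finset.range (n + 1), ((S h ^ k) y - y))]

theorem isClosed_hasDerivAtOrigin (hS : IsContractionSemigroup S) :
    IsClosed {q : X × X | HasDerivAtOrigin S q.1 q.2} := by
  refine isClosed_of_closure_subset fun ⟨φ, y⟩ hφ => ?_
  change Tendsto _ _ _
  rw [Metric.tendsto_nhds]
  intro ε hε
  have h1 : ∀ᶠ s in 𝓝 (0 : ℝ≥0), dist (S s y) y < ε / 2 :=
    Metric.tendsto_nhds.1 (hS.tendsto_zero y) _ (half_pos hε)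
  obtain ⟨δ, hδ, hball⟩ := Metric.eventually_nhds_iff.1 h1
  filter_upwards [nhdsWithin_le_nhds (Metric.ball_mem_nhds (0 : ℝ≥0) hδ), self_mem_nhdsWithin]
    with t ht htpos
  have ht0 : (0 : ℝ) < t := by exact_mod_cast htpos
  have htδ : (t : ℝ) < δ := by simpa [NNReal.dist_eq] using ht
  have h2 := hS.norm_sub_sub_smul_le hφ (t := t) (half_pos hε).le fun s hs => by
    rw [← dist_eq_norm]
    refine (hball ?_).le
    have : (s : ℝ) ≤ t := by exact_mod_cast hs
    simpa [NNReal.dist_eq] using this.trans_lt htδ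
  have h3 : (t : ℝ)⁻¹ • (S t φ - S 0 φ) - y = (t : ℝ)⁻¹ • (S t φ - φ - (t : ℝ) • y) := by
    rw [hS.map_zero, smul_sub _ _ ((t : ℝ) • y), inv_smul_smul₀ ht0.ne']
    rfl
  rw [dist_eq_norm, h3, norm_smul, norm_inv, Real.norm_of_nonneg ht0.le]
  calc (t : ℝ)⁻¹ * ‖S t φ - φ - (t : ℝ) • y‖ ≤ (t : ℝ)⁻¹ * (t * (ε / 2)) := by gcongr
    _ = ε / 2 := by field_simp
    _ < ε := half_lt_self hε

theorem dense_setOf_hasDerivAtOrigin [CompleteSpace X] (hS : IsContractionSemigroup S) :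
    Dense {φ : X | ∃ y, HasDerivAtOrigin S φ y} := by
  intro φ
  let u : ℝ → X := fun s => S s.toNNReal φ
  have hu : Continuous u := (hS.continuous_apply φ).comp continuous_real_toNNReal
  let v : ℝ → X := fun t => ∫ s in (0 : ℝ)..t, u s
  have hv : ∀ t, HasDerivAt v (u t) t := fun t => hu.integral_hasStrictDerivAt 0 t |>.hasDerivAt
  -- The averages of the orbit, v(t)/t, approximate φ. This shift formula puts v τ in the domain,
  -- with derivative u τ - φ.
  have hSv : ∀ τ h : ℝ≥0, S h (v τ) = v (τ + h) - v h := by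
    intro τ h
    have h1 : S h (v τ) = ∫ s in (0 : ℝ)..τ, S h (u s) := by
      rw [(S h).intervalIntegral_comp_comm (hu.intervalIntegrable _ _)]
    have h2 : ∫ s in (0 : ℝ)..τ, S h (u s) = ∫ s in (0 : ℝ)..τ, u (s + h) := by
      refine intervalIntegral.integral_congr fun s hs => ?_
      rw [uIcc_of_le τ.coe_nonneg] at hs
      simp only [u]
      rw [Real.toNNReal_add hs.1 h.coe_nonneg, Real.toNNReal_coe, add_comm, hS.map_add]
      rfl
    rw [h1, h2, intervalIntegral.integral_comp_add_right, zero_add]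
    exact (intervalIntegral.integral_interval_sub_left (hu.intervalIntegrable _ _)
      (hu.intervalIntegrable _ _)).symm
  have hcoe : Tendsto (fun t : ℝ≥0 => (t : ℝ)) (𝓝[>] 0) (𝓝[≠] 0) := by
    refine tendsto_nhdsWithin_iff.2 ⟨?_, ?_⟩
    · exact (NNReal.continuous_coe.tendsto 0).mono_left nhdsWithin_le_nhds
    · filter_upwards [self_mem_nhdsWithin] with t ht
      exact_mod_cast ne_of_gt ht
  have hdom : ∀ τ : ℝ≥0, HasDerivAtOrigin S (v τ) (u τ - φ) := by
    intro τ
    have h1 := (hasDerivAt_iff_tendsto_slope_zero.1 (hv τ)).comp hcoe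
    have h2 := (hasDerivAt_iff_tendsto_slope_zero.1 (hv 0)).comp hcoe
    have h3 : u 0 = φ := by simp [u, hS.map_zero]
    have h4 : v 0 = 0 := by simp [v]
    rw [h3] at h2
    refine (h1.sub h2).congr fun t => ?_
    simp only [Function.comp_apply, zero_add, h4, sub_zero, hSv, hS.map_zero,
      ContinuousLinearMap.id_apply, ← smul_sub]
    congr 1
    abel
  have h5 := (hasDerivAt_iff_tendsto_slope_zero.1 (hv 0)).comp hcoe
  have h6 : u 0 = φ := by simp [u, hS.map_zero]
  rw [h6] at h5
  have := nhdsGT_zero_nnreal_neBot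
  refine mem_closure_of_tendsto h5 (Eventually.of_forall fun t => ⟨(t : ℝ)⁻¹ • (u t - φ), ?_⟩)
  have h7 := hdom t
  have h8 := h7.const_smul (t : ℝ)⁻¹
  refine h8.congr fun r => ?_
  have h9 : ∀ (L : X →L[𝕜] X) (r : ℝ) (w : X), L (r • w) = r • L w :=
    fun L r w => map_real_smul L.toLinearMap.toAddMonoidHom L.continuous _ _
  have h4 : v 0 = 0 := by simp [v]
  simp only [Function.comp_apply, zero_add, h4, sub_zero, h9, ← smul_sub]
  rw [smul_comm]

end IsContractionSemigroup

/-! ### Chernoff's theorem -/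

section ChernoffTheorem

variable {F S : ℝ≥0 → X →L[𝕜] X} {a : ℝ}

/-- The orbit of (φ, y) over [0, R] is a compact part of the graph of the generator, so the
F-defects along it are uniformly small. Multiplying `sum_chernoffDefect` by h leaves two averages of
small defects and the endpoint term h (F^n φ - S^n φ), which is O(h). -/
theorem eventually_norm_smul_sum_sub_le_of_hasDerivAtOrigin (hS : IsContractionSemigroup S)
    (ha : 0 ≤ a) (hF0 : F 0 = ContinuousLinearMap.id 𝕜 X)
    (hF : ∀ t : ℝ≥0, ‖F t‖ ≤ Real.exp (a * t))
    (hFS : {q : X × X | HasDerivAtOrigin S q.1 q.2} ⊆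
      closure {q : X × X | HasDerivAtOrigin F q.1 q.2})
    {φ y : X} (hφ : HasDerivAtOrigin S φ y) (R : ℝ≥0) {ε : ℝ} (hε : 0 < ε) :
    ∀ᶠ h in 𝓝[>] (0 : ℝ≥0), ∀ n : ℕ, n * h ≤ R →
      ‖(h : ℝ) • ∑ k ∈ Finset.range n, ((F h ^ k) φ - (S h ^ k) φ)‖ ≤ ε := by
  set M := Real.exp (a * R) with hM
  have hM0 : 0 < M := Real.exp_pos _
  have hK : IsCompact ((fun s => (S s φ, S s y)) '' Icc 0 R) :=
    isCompact_Icc.image ((hS.continuous_apply φ).prodMk (hS.continuous_apply y))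
  have hKF : ((fun s => (S s φ, S s y)) '' Icc 0 R) ⊆
      closure {q : X × X | HasDerivAtOrigin F q.1 q.2} := by
    rintro _ ⟨s, -, rfl⟩
    exact hFS (hS.hasDerivAtOrigin_apply hφ s)
  -- The two averages of defects contribute R δ and R M δ, together at most ε / 3. The extra 1 keeps
  -- the denominator positive when R = 0.
  have hδ : 0 < ε / 3 / (R * (M + 1) + 1) := by positivity
  have h1 := eventually_forall_norm_chernoffDefect_le ha hF0 hF hK hKF R hδ
  have h2 := eventually_norm_chernoffDefect_le_of_hasDerivAtOrigin le_rfl hS.map_zero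
    hS.norm_le_exp (p := (φ, y)) hφ R hδ
  set δ := ε / 3 / (R * (M + 1) + 1) with hδd
  have hRδ : R * ((M + 1) * δ) ≤ ε / 3 := by
    rw [← mul_assoc, hδd, mul_div_assoc', div_le_iff₀ (by positivity)]
    nlinarith
  have h3 : ∀ᶠ h : ℝ≥0 in 𝓝[>] 0, (h : ℝ) * ((M + 1) * ‖φ‖) < ε / 3 := by
    have : Tendsto (fun h : ℝ≥0 => (h : ℝ) * ((M + 1) * ‖φ‖)) (𝓝[>] 0) (𝓝 0) := by
      have : Continuous (fun h : ℝ≥0 => (h : ℝ) * ((M + 1) * ‖φ‖)) := by fun_prop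
      simpa using (this.tendsto 0).mono_left (nhdsWithin_le_nhds (s := Ioi 0))
    exact this.eventually_lt_const (by positivity)
  filter_upwards [h1, h2, h3] with h hh1 hh2 hh3 n hn
  have hid := sum_chernoffDefect (F h) (S h) h n φ y
  have e1 : ‖(h : ℝ) • ∑ k ∈ Finset.range n,
      chernoffDefect (F h) h (n - k) ((S h ^ k) φ, (S h ^ k) y)‖ ≤ R * δ := by
    refine norm_smul_sum_le hn hδ.le fun k hk => ?_
    refine hh1 _ ⟨k * h, ⟨zero_le, mul_le_of_le_nat hn hk.le⟩, ?_⟩ _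
      (mul_le_of_le_nat hn (Nat.sub_le _ _))
    simp only [hS.map_nsmul]
  have e2 : ‖(h : ℝ) • ∑ k ∈ Finset.range n,
      (F h ^ k) (chernoffDefect (S h) h (n - k) (φ, y))‖ ≤ R * (M * δ) := by
    refine norm_smul_sum_le hn (by positivity) fun k hk => ?_
    refine (norm_pow_apply_le_exp ha hF (mul_le_of_le_nat hn hk.le) _).trans ?_
    gcongr
    exact hh2 _ (mul_le_of_le_nat hn (Nat.sub_le _ _))
  have e3 : ‖(h : ℝ) • ((F h ^ n) φ - (S h ^ n) φ)‖ ≤ h * ((M + 1) * ‖φ‖) := by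
    rw [norm_smul, Real.norm_of_nonneg h.coe_nonneg]
    gcongr
    linarith [norm_sub_le ((F h ^ n) φ) ((S h ^ n) φ), norm_pow_apply_le_exp ha hF hn φ,
      hS.norm_pow_apply_le h n φ]
  have hid' : (h : ℝ) • ∑ k ∈ Finset.range n, ((F h ^ k) φ - (S h ^ k) φ) =
      (h : ℝ) • ∑ k ∈ Finset.range n,
        chernoffDefect (F h) h (n - k) ((S h ^ k) φ, (S h ^ k) y) -
      (h : ℝ) • ∑ k ∈ Finset.range n, (F h ^ k) (chernoffDefect (S h) h (n - k) (φ, y)) -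
      (h : ℝ) • ((F h ^ n) φ - (S h ^ n) φ) := by
    rw [hid, smul_add, smul_add]
    abel
  rw [hid']
  refine (norm_sub_le _ _).trans ?_
  linarith [norm_sub_le ((h : ℝ) • ∑ k ∈ Finset.range n,
        chernoffDefect (F h) h (n - k) ((S h ^ k) φ, (S h ^ k) y))
      ((h : ℝ) • ∑ k ∈ Finset.range n, (F h ^ k) (chernoffDefect (S h) h (n - k) (φ, y)))]

/-- The averaged differences are bounded by R (M + 1) uniformly in h and n, so density of the domain
suffices. The extension matters because it is next applied to the generator value y, which need not
lie in the domain. -/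
theorem eventually_norm_smul_sum_sub_le [CompleteSpace X] (hS : IsContractionSemigroup S)
    (ha : 0 ≤ a) (hF0 : F 0 = ContinuousLinearMap.id 𝕜 X)
    (hF : ∀ t : ℝ≥0, ‖F t‖ ≤ Real.exp (a * t))
    (hFS : {q : X × X | HasDerivAtOrigin S q.1 q.2} ⊆
      closure {q : X × X | HasDerivAtOrigin F q.1 q.2})
    (φ : X) (R : ℝ≥0) {ε : ℝ} (hε : 0 < ε) :
    ∀ᶠ h in 𝓝[>] (0 : ℝ≥0), ∀ n : ℕ, n * h ≤ R →
      ‖(h : ℝ) • ∑ k ∈ Finset.range n, ((F h ^ k) φ - (S h ^ k) φ)‖ ≤ ε := by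
  set M := Real.exp (a * R) with hM
  have hM0 : 0 < M := Real.exp_pos _
  have hδ : 0 < ε / 2 / (R * (M + 1) + 1) := by positivity
  obtain ⟨ψ, ⟨y, hy⟩, hψ⟩ := Metric.mem_closure_iff.1 (hS.dense_setOf_hasDerivAtOrigin φ) _ hδ
  rw [dist_eq_norm] at hψ
  filter_upwards [eventually_norm_smul_sum_sub_le_of_hasDerivAtOrigin hS ha hF0 hF hFS hy R
    (half_pos hε)] with h hh n hn
  have e1 : ‖(h : ℝ) • ∑ k ∈ Finset.range n, ((F h ^ k) (φ - ψ) - (S h ^ k) (φ - ψ))‖ ≤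
      R * ((M + 1) * ‖φ - ψ‖) := by
    refine norm_smul_sum_le hn (by positivity) fun k hk => ?_
    linarith [norm_sub_le ((F h ^ k) (φ - ψ)) ((S h ^ k) (φ - ψ)),
      norm_pow_apply_le_exp ha hF (mul_le_of_le_nat hn hk.le) (φ - ψ),
      hS.norm_pow_apply_le h k (φ - ψ)]
  have e2 : R * ((M + 1) * ‖φ - ψ‖) ≤ ε / 2 := by
    calc R * ((M + 1) * ‖φ - ψ‖) ≤ R * ((M + 1) * (ε / 2 / (R * (M + 1) + 1))) := by gcongr
      _ ≤ ε / 2 := by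
        rw [← mul_assoc, mul_div_assoc', div_le_iff₀ (by positivity)]
        nlinarith
  have hid : (h : ℝ) • ∑ k ∈ Finset.range n, ((F h ^ k) φ - (S h ^ k) φ) =
      (h : ℝ) • ∑ k ∈ Finset.range n, ((F h ^ k) (φ - ψ) - (S h ^ k) (φ - ψ)) +
      (h : ℝ) • ∑ k ∈ Finset.range n, ((F h ^ k) ψ - (S h ^ k) ψ) := by
    simp only [map_sub, Finset.sum_sub_distrib, smul_sub]
    abel
  rw [hid]
  refine (norm_add_le _ _).trans ?_
  linarith [hh n hn]

/-- For ψ in the domain with generator value y, subtracting the integral equations for F and S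
bounds the difference of powers by two defects and the averaged difference at y. General φ follow by
density. -/
theorem eventually_norm_pow_sub_le [CompleteSpace X] (hS : IsContractionSemigroup S)
    (ha : 0 ≤ a) (hF0 : F 0 = ContinuousLinearMap.id 𝕜 X)
    (hF : ∀ t : ℝ≥0, ‖F t‖ ≤ Real.exp (a * t))
    (hFS : {q : X × X | HasDerivAtOrigin S q.1 q.2} ⊆
      closure {q : X × X | HasDerivAtOrigin F q.1 q.2})
    (φ : X) (R : ℝ≥0) {ε : ℝ} (hε : 0 < ε) :
    ∀ᶠ h in 𝓝[>] (0 : ℝ≥0), ∀ n : ℕ, n * h ≤ R → ‖(F h ^ n) φ - (S h ^ n) φ‖ ≤ ε := by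
  set M := Real.exp (a * R) with hM
  have hM0 : 0 < M := Real.exp_pos _
  have hδ : 0 < ε / 2 / (M + 1) := by positivity
  have hε' : 0 < ε / 6 := by positivity
  obtain ⟨ψ, ⟨y, hy⟩, hψ⟩ := Metric.mem_closure_iff.1 (hS.dense_setOf_hasDerivAtOrigin φ) _ hδ
  rw [dist_eq_norm, lt_div_iff₀ (by positivity)] at hψ
  filter_upwards [eventually_norm_smul_sum_sub_le hS ha hF0 hF hFS y R hε',
    eventually_norm_chernoffDefect_le_of_hasDerivAtOrigin le_rfl hS.map_zero
      hS.norm_le_exp (p := (ψ, y)) hy R hε',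
    eventually_forall_norm_chernoffDefect_le ha hF0 hF (isCompact_singleton (x := (ψ, y)))
      (by simpa using hFS hy) R hε'] with h h1 h2 h3 n hn
  have e1 := dist_pow_le_of_hasDerivAtOrigin (h3 _ rfl n hn) (h2 n hn) (h1 n hn)
  have hid : (F h ^ n) φ - (S h ^ n) φ = (F h ^ n) (φ - ψ) - (S h ^ n) (φ - ψ) +
      ((F h ^ n) ψ - (S h ^ n) ψ) := by
    simp only [map_sub]
    abel
  rw [hid]
  refine (norm_add_le _ _).trans ?_
  linarith [norm_sub_le ((F h ^ n) (φ - ψ)) ((S h ^ n) (φ - ψ)),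
      norm_pow_apply_le_exp ha hF hn (φ - ψ), hS.norm_pow_apply_le h n (φ - ψ)]

variable [IsScalarTower ℝ 𝕜 X]

theorem mem_graph_semigroupGenerator {φ y : X} :
    (φ, y) ∈ (semigroupGenerator S).graph ↔ HasDerivAtOrigin S φ y := by
  rw [LinearPMap.mem_graph_iff]
  constructor
  · rintro ⟨z, rfl, hz⟩
    exact (semigroupGenerator_apply_eq_iff S z y).1 hz
  · intro h
    exact ⟨⟨φ, y, h⟩, rfl, (semigroupGenerator_apply_eq_iff S _ y).2 h⟩

/-- The graph over the core D lies in the graph of the derivative of F at 0, and it is dense in the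
graph of the generator. This inclusion is all that Chernoff's theorem uses of the core. -/
theorem ChernoffEquivalent.subset_closure (hFS : ChernoffEquivalent F S) :
    {q : X × X | HasDerivAtOrigin S q.1 q.2} ⊆
      closure {q : X × X | HasDerivAtOrigin F q.1 q.2} := by
  obtain ⟨hF0, -, D, hD, h⟩ := hFS
  rintro ⟨φ, y⟩ hφ
  refine closure_mono ?_ (hD.graph_subset_closure (mem_graph_semigroupGenerator.2 hφ))
  rintro ⟨ψ, z⟩ hψ
  obtain ⟨w, rfl, rfl⟩ := (LinearPMap.mem_graph_iff _).1 hψ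
  have hw : (w : X) ∈ D := w.2.1
  have h1 := h w hw
  change Tendsto _ _ _
  simp only [hF0, ContinuousLinearMap.id_apply]
  exact h1

theorem ChernoffEquivalent.eventually_norm_pow_sub_le [CompleteSpace X]
    (hS : IsContractionSemigroup S) (hFS : ChernoffEquivalent F S)
    (φ : X) (R : ℝ≥0) {ε : ℝ} (hε : 0 < ε) :
    ∀ᶠ h in 𝓝[>] (0 : ℝ≥0), ∀ n : ℕ, n * h ≤ R → ‖(F h ^ n) φ - S (n * h) φ‖ ≤ ε := by
  obtain ⟨a, ha, hF⟩ := hFS.2.1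
  simp_rw [hS.map_nsmul]
  exact _root_.eventually_norm_pow_sub_le hS ha hFS.1 hF hFS.subset_closure φ R hε

/-- **Chernoff's theorem**: iterates of a family which is Chernoff equivalent to a contraction
semigroup converge to this semigroup, locally uniformly in time. -/
theorem ChernoffEquivalent.tendstoLocallyUniformly [CompleteSpace X]
    (hS : IsContractionSemigroup S) (hFS : ChernoffEquivalent F S) (φ : X) :
    TendstoLocallyUniformly (fun (n : ℕ) (t : ℝ≥0) => (F (t / (n : ℝ≥0)) ^ n) φ)
      (fun t => S t φ) atTop := by
  rw [Metric.tendstoLocallyUniformly_iff]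
  intro ε hε t₀
  refine ⟨Iio (t₀ + 1), Iio_mem_nhds (lt_add_one t₀), ?_⟩
  have h1 := hFS.eventually_norm_pow_sub_le hS φ (t₀ + 1) (half_pos hε)
  rw [eventually_nhdsWithin_iff] at h1
  obtain ⟨δ, hδ, hball⟩ := Metric.eventually_nhds_iff.1 h1
  obtain ⟨N, hN⟩ := exists_nat_gt (((t₀ : ℝ) + 1) / δ)
  filter_upwards [eventually_gt_atTop N] with n hn t ht
  have hn0 : 0 < n := (Nat.zero_le N).trans_lt hn
  have hnt : (n : ℝ≥0) * (t / n) = t := by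
    have : (n : ℝ≥0) ≠ 0 := by positivity
    field_simp
  -- The estimate only covers steps h > 0; at t = 0 both sides equal φ.
  rcases eq_or_ne t 0 with rfl | ht0
  · simpa [hFS.1, hS.map_zero, ← ContinuousLinearMap.one_def] using hε
  have h2 : dist (t / (n : ℝ≥0)) 0 < δ := by
    rw [NNReal.dist_eq, NNReal.coe_zero, sub_zero, NNReal.abs_eq, NNReal.coe_div, NNReal.coe_natCast,
      div_lt_iff₀ (by positivity)]
    have h3 : (t : ℝ) < t₀ + 1 := by exact_mod_cast ht
    rw [div_lt_iff₀ hδ] at hN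
    have h4 : (N : ℝ) < n := by exact_mod_cast hn
    nlinarith
  have h5 := hball h2 (div_pos (pos_iff_ne_zero.2 ht0) (by positivity)) n (by rw [hnt]; exact ht.le)
  rw [hnt] at h5
  rw [dist_comm, dist_eq_norm]
  linarith

end ChernoffTheorem

end Chernoff

/-! ### Uniqueness of Laplace transforms -/

section LaplaceUniqueness

open BoundedContinuousFunction

theorem integrable_exp_neg_mul (P : Measure ℝ≥0) [IsFiniteMeasure P] {x : ℝ} (hx : 0 ≤ x) :
    Integrable (fun s : ℝ≥0 => Real.exp (-(s * x))) P := by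
  refine Integrable.of_bound (by fun_prop) 1 (Eventually.of_forall fun s => ?_)
  rw [Real.norm_of_nonneg (Real.exp_pos _).le, Real.exp_le_one_iff]
  have : 0 ≤ (s : ℝ) * x := mul_nonneg s.coe_nonneg hx
  linarith

theorem tendsto_integral_exp_neg_mul (P : Measure ℝ≥0) [IsFiniteMeasure P] :
    Tendsto (fun n : ℕ => ∫ s : ℝ≥0, Real.exp (-(s * (1 / ((n : ℝ) + 1)))) ∂P) atTop
      (𝓝 (P.real univ)) := by
  have h1 : P.real univ = ∫ _ : ℝ≥0, (1 : ℝ) ∂P := by simp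
  rw [h1]
  refine tendsto_integral_of_dominated_convergence (fun _ => 1) (fun n => by fun_prop)
    (integrable_const _) (fun n => Eventually.of_forall fun s => ?_)
    (Eventually.of_forall fun s => ?_)
  · rw [Real.norm_of_nonneg (Real.exp_pos _).le, Real.exp_le_one_iff]
    have : 0 ≤ (s : ℝ) * (1 / ((n : ℝ) + 1)) := by positivity
    linarith
  · have h2 := (tendsto_one_div_add_atTop_nhds_zero_nat (𝕜 := ℝ)).const_mul (s : ℝ)
    simpa [Function.comp_def] using (Real.continuous_exp.tendsto _).comp h2.neg

/-- A finite measure on `[0, ∞)` is determined by its Laplace transform on `(0, ∞)`. -/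
theorem MeasureTheory.Measure.ext_of_integral_exp_neg_mul {P P' : Measure ℝ≥0} [IsFiniteMeasure P]
    [IsFiniteMeasure P'] (h : ∀ x : ℝ, 0 < x →
      ∫ s : ℝ≥0, Real.exp (-(s * x)) ∂P = ∫ s : ℝ≥0, Real.exp (-(s * x)) ∂P') : P = P' := by
  have hmass : P.real univ = P'.real univ := by
    refine tendsto_nhds_unique (tendsto_integral_exp_neg_mul P)
      ((tendsto_integral_exp_neg_mul P').congr fun n => (h _ (by positivity)).symm)
  let e : ℝ≥0 →ᵇ ℝ := BoundedContinuousFunction.ofNormedAddCommGroup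
    (fun s : ℝ≥0 => Real.exp (-s)) (by fun_prop) 1 fun s => by
      rw [Real.norm_of_nonneg (Real.exp_pos _).le, Real.exp_le_one_iff]
      simp
  -- Polynomials in e^{-s} separate points, and their integrals are combinations of Laplace
  -- transforms at natural numbers. The constant term is the total mass, recovered in `hmass` by
  -- letting x tend to 0.
  let A : StarSubalgebra ℝ (ℝ≥0 →ᵇ ℝ) :=
    { (Polynomial.aeval (R := ℝ) e).range with
      star_mem' := fun {g} hg => by
        have : star g = g := by ext; simp
        rwa [this] }
  have hA : ∀ g, g ∈ A ↔ ∃ p : Polynomial ℝ, Polynomial.aeval e p = g := fun g => Iff.rfl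
  refine ext_of_forall_mem_subalgebra_integral_eq_of_polish (𝕜 := ℝ) (A := A) ?_ ?_
  · intro x y hxy
    refine ⟨e, ⟨toContinuousMapStarₐ ℝ e, ⟨e, (hA e).2 ⟨Polynomial.X, by simp⟩, rfl⟩, rfl⟩, ?_⟩
    intro hxy'
    have h1 : Real.exp (-(x : ℝ)) = Real.exp (-(y : ℝ)) := hxy'
    exact hxy (NNReal.coe_injective (neg_injective (Real.exp_injective h1)))
  · intro g hg
    obtain ⟨p, rfl⟩ := (hA g).1 hg
    induction p using Polynomial.induction_on' with
    | add p q hp hq =>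
      simp only [map_add, BoundedContinuousFunction.coe_add, Pi.add_apply]
      rw [integral_add (BoundedContinuousFunction.integrable _ _)
        (BoundedContinuousFunction.integrable _ _),
        integral_add (BoundedContinuousFunction.integrable _ _)
        (BoundedContinuousFunction.integrable _ _), hp ((hA _).2 ⟨p, rfl⟩), hq ((hA _).2 ⟨q, rfl⟩)]
    | monomial n a =>
      have h2 : ∀ s : ℝ≥0, (Polynomial.aeval e (Polynomial.monomial n a)) s =
          a * Real.exp (-(s * n)) := by
        intro s
        rw [Polynomial.aeval_monomial]
        have : Real.exp (-(s * n)) = e s ^ n := by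
          change _ = Real.exp (-(s : ℝ)) ^ n
          rw [← Real.exp_nat_mul]
          congr 1
          ring
        rw [this, Algebra.algebraMap_eq_smul_one]
        simp
      simp_rw [h2, integral_const_mul]
      congr 1
      rcases n.eq_zero_or_pos with rfl | hn
      · simpa using hmass
      · exact h n (by exact_mod_cast hn)

end LaplaceUniqueness

/-! ### Compound Poisson laws and averages of semigroups -/

section CompoundPoisson

/-- The `n`-th convolution power of a measure. -/
noncomputable def convPow (μ : Measure ℝ≥0) : ℕ → Measure ℝ≥0
  | 0 => Measure.dirac 0
  | n + 1 => μ.conv (convPow μ n)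

instance isFiniteMeasure_convPow (μ : Measure ℝ≥0) [IsFiniteMeasure μ] (n : ℕ) :
    IsFiniteMeasure (convPow μ n) := by
  induction n with
  | zero => unfold convPow; infer_instance
  | succ n ih => unfold convPow; infer_instance

theorem measureReal_conv_univ (α β : Measure ℝ≥0) [IsFiniteMeasure α] [IsFiniteMeasure β] :
    (α.conv β).real univ = α.real univ * β.real univ := by
  rw [measureReal_def, Measure.conv, Measure.map_apply (by fun_prop) MeasurableSet.univ,
    preimage_univ, Measure.prod_apply MeasurableSet.univ]
  simp [measureReal_def, mul_comm]

theorem measureReal_convPow_univ (μ : Measure ℝ≥0) [IsFiniteMeasure μ] (n : ℕ) :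
    (convPow μ n).real univ = μ.real univ ^ n := by
  induction n with
  | zero => simp [convPow]
  | succ n ih => rw [convPow, measureReal_conv_univ, ih, pow_succ']

/-- The law at time `t` of the subordinator with drift `lam`, killing rate `σ` and finite Lévy
measure `μ`. -/
noncomputable def compoundPoisson (σ lam : ℝ≥0) (μ : Measure ℝ≥0) (t : ℝ≥0) : Measure ℝ≥0 :=
  ENNReal.ofReal (Real.exp (-((σ + μ.real univ) * t))) • Measure.sum fun n : ℕ =>
    ENNReal.ofReal ((t : ℝ) ^ n / n.factorial) • (Measure.dirac (lam * t)).conv (convPow μ n)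

/-- The n-th term has mass (t |μ|)^n / n!, so a bounded function is dominated by an exponential
series. The case f = 1 gives finiteness of the compound Poisson law. -/
theorem integrable_sum_convPow {E : Type*} [NormedAddCommGroup E] (s : ℝ≥0)
    (μ : Measure ℝ≥0) [IsFiniteMeasure μ] (t : ℝ≥0) {f : ℝ≥0 → E} (hf : StronglyMeasurable f)
    {C : ℝ} (hC : ∀ s, ‖f s‖ ≤ C) :
    Integrable f (Measure.sum fun n : ℕ => ENNReal.ofReal ((t : ℝ) ^ n / n.factorial) •
      (Measure.dirac s).conv (convPow μ n)) := by
  have hC0 : 0 ≤ C := (norm_nonneg _).trans (hC 0)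
  have hf' : ∀ (α : Measure ℝ≥0) [IsFiniteMeasure α], Integrable f α := fun α _ =>
    Integrable.of_bound hf.aestronglyMeasurable C (Eventually.of_forall hC)
  refine integrable_sum_measure (fun n => (hf' _).smul_measure ENNReal.ofReal_ne_top) ?_
  have hs : Summable fun n : ℕ => C * ((t * μ.real univ) ^ n / n.factorial) :=
    (Real.summable_pow_div_factorial _).mul_left C
  refine Summable.of_nonneg_of_le (fun n => integral_nonneg fun _ => norm_nonneg _)
    (fun n => ?_) hs
  rw [integral_smul_measure, ENNReal.toReal_ofReal (by positivity), smul_eq_mul]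
  calc (t : ℝ) ^ n / n.factorial * ∫ r, ‖f r‖ ∂((Measure.dirac s).conv (convPow μ n))
      ≤ (t : ℝ) ^ n / n.factorial *
        ∫ r, C ∂((Measure.dirac s).conv (convPow μ n)) := by
        gcongr
        · exact (hf' _).norm
        · exact integrable_const _
        · exact fun r => hC r
    _ = C * ((t * μ.real univ) ^ n / n.factorial) := by
        rw [integral_const, measureReal_conv_univ, measureReal_convPow_univ]
        simp only [measureReal_def, measure_univ, ENNReal.toReal_one, smul_eq_mul]
        ring

instance isFiniteMeasure_compoundPoisson (σ lam : ℝ≥0) (μ : Measure ℝ≥0) [IsFiniteMeasure μ]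
    (t : ℝ≥0) : IsFiniteMeasure (compoundPoisson σ lam μ t) := by
  have h1 := integrable_sum_convPow (lam * t) μ t
    (stronglyMeasurable_const (b := (1 : ℝ))) (C := 1) (by simp)
  have h2 := h1.smul_measure
    (c := ENNReal.ofReal (Real.exp (-((σ + μ.real univ) * t)))) ENNReal.ofReal_ne_top
  exact (integrable_const_iff.1 h2).resolve_left one_ne_zero

variable {𝕜 X : Type*} [RCLike 𝕜] [NormedAddCommGroup X] [NormedSpace 𝕜 X] [NormedSpace ℝ X]
  [IsScalarTower ℝ 𝕜 X]

section Average

variable {K : ℝ≥0 → X →L[𝕜] X}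

omit [NormedSpace ℝ X] [IsScalarTower ℝ 𝕜 X] in
theorem integrable_apply_of_norm_le_one (hK : ∀ t, ‖K t‖ ≤ 1)
    (hKm : ∀ φ : X, StronglyMeasurable fun t => K t φ) (α : Measure ℝ≥0) [IsFiniteMeasure α]
    (φ : X) : Integrable (fun s => K s φ) α :=
  Integrable.of_bound (hKm φ).aestronglyMeasurable ‖φ‖ (Eventually.of_forall fun t => by
    simpa using (K t).le_of_opNorm_le (hK t) φ)

/-- The operator `φ ↦ ∫ K s φ α(ds)`. -/
noncomputable def averageOperator (hK : ∀ t, ‖K t‖ ≤ 1)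
    (hKm : ∀ φ : X, StronglyMeasurable fun t => K t φ) (α : Measure ℝ≥0) [IsFiniteMeasure α] :
    X →L[𝕜] X :=
  LinearMap.mkContinuous
    { toFun := fun φ => ∫ s, K s φ ∂α
      map_add' := fun φ ψ => by
        simp_rw [map_add]
        exact integral_add (integrable_apply_of_norm_le_one hK hKm α φ)
          (integrable_apply_of_norm_le_one hK hKm α ψ)
      map_smul' := fun c φ => by
        simp_rw [map_smul]
        exact integral_smul c _ }
    (α.real univ) fun φ => by
      rw [mul_comm]
      exact norm_integral_le_of_norm_le_const (Eventually.of_forall fun t => by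
        simpa using (K t).le_of_opNorm_le (hK t) φ)

theorem norm_averageOperator_le (hK : ∀ t, ‖K t‖ ≤ 1)
    (hKm : ∀ φ : X, StronglyMeasurable fun t => K t φ) (α : Measure ℝ≥0) [IsFiniteMeasure α] :
    ‖averageOperator hK hKm α‖ ≤ α.real univ :=
  LinearMap.mkContinuous_norm_le _ measureReal_nonneg _

end Average

namespace IsContractionSemigroup

variable {T : ℝ≥0 → X →L[𝕜] X}

omit [NormedSpace ℝ X] [IsScalarTower ℝ 𝕜 X] in
theorem stronglyMeasurable_apply (hT : IsContractionSemigroup T) (φ : X) :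
    StronglyMeasurable fun t => T t φ := (hT.continuous_apply φ).stronglyMeasurable

/-- The operator `φ ↦ ∫ T s φ α(ds)` for a contraction semigroup `T`. -/
noncomputable def average (hT : IsContractionSemigroup T) (α : Measure ℝ≥0) [IsFiniteMeasure α] :
    X →L[𝕜] X :=
  averageOperator hT.norm_le_one hT.stronglyMeasurable_apply α

theorem average_apply (hT : IsContractionSemigroup T) (α : Measure ℝ≥0) [IsFiniteMeasure α]
    (φ : X) : hT.average α φ = ∫ s, T s φ ∂α := rfl

omit [NormedSpace ℝ X] [IsScalarTower ℝ 𝕜 X] in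
theorem integrable_apply (hT : IsContractionSemigroup T) (α : Measure ℝ≥0) [IsFiniteMeasure α]
    (φ : X) : Integrable (fun s => T s φ) α :=
  integrable_apply_of_norm_le_one hT.norm_le_one hT.stronglyMeasurable_apply α φ

variable [CompleteSpace X]

theorem commute_average (hT : IsContractionSemigroup T) (α : Measure ℝ≥0) [IsFiniteMeasure α]
    (t : ℝ≥0) : Commute (T t) (hT.average α) := by
  ext φ
  change T t (∫ s, T s φ ∂α) = ∫ s, T s (T t φ) ∂α
  rw [← (T t).integral_comp_comm (hT.integrable_apply α φ)]
  congr with s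
  exact congr($(hT.commute t s) φ)

/-- Fubini together with T_{s+r} = T_s T_r: averaging is multiplicative for convolution. -/
theorem average_conv (hT : IsContractionSemigroup T) (α β : Measure ℝ≥0) [IsFiniteMeasure α]
    [IsFiniteMeasure β] : hT.average (α.conv β) = hT.average α * hT.average β := by
  ext φ
  rw [mul_apply_eq_comp, average_apply, average_apply, average_apply,
    integral_conv (hT.integrable_apply _ φ)]
  congr with s
  rw [← (T s).integral_comp_comm (hT.integrable_apply β φ)]
  congr with r
  rw [hT.map_add]
  rfl

theorem average_dirac (hT : IsContractionSemigroup T) (s : ℝ≥0) :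
    hT.average (Measure.dirac s) = T s := by
  ext φ
  rw [average_apply, integral_dirac]

theorem average_convPow (hT : IsContractionSemigroup T) (μ : Measure ℝ≥0) [IsFiniteMeasure μ]
    (n : ℕ) : hT.average (convPow μ n) = hT.average μ ^ n := by
  induction n with
  | zero =>
    change hT.average (Measure.dirac 0) = _
    rw [average_dirac, hT.map_zero, pow_zero]
    rfl
  | succ n ih =>
    rw [pow_succ', ← ih, ← average_conv]
    rfl

/-- By multiplicativity, the series of convolution powers averages to the exponential series of the
operator ∫ T_s μ(ds), and the Dirac mass gives the drift factor. -/
theorem average_compoundPoisson (hT : IsContractionSemigroup T) (σ lam : ℝ≥0) (μ : Measure ℝ≥0)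
    [IsFiniteMeasure μ] (t : ℝ≥0) (φ : X) :
    hT.average (compoundPoisson σ lam μ t) φ = Real.exp (-((σ + μ.real univ) * t)) •
      T (lam * t) (NormedSpace.exp (((t : ℝ) : 𝕜) • hT.average μ) φ) := by
  rw [average_apply, compoundPoisson, integral_smul_measure,
    ENNReal.toReal_ofReal (Real.exp_pos _).le]
  congr 1
  have h1 := hasSum_integral_measure (integrable_sum_convPow (lam * t) μ t
    (hT.stronglyMeasurable_apply φ) fun s => hT.norm_apply_le s φ)
  have h2 := NormedSpace.exp_series_hasSum_exp' (𝕂 := 𝕜) (((t : ℝ) : 𝕜) • hT.average μ)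
  have h3 := h2.mapL ((T (lam * t)).comp (ContinuousLinearMap.apply 𝕜 X φ))
  refine HasSum.unique ?_ h3
  convert h1 using 2 with n
  symm
  rw [integral_smul_measure, ENNReal.toReal_ofReal (by positivity)]
  have h4 := congr($(hT.average_conv (Measure.dirac (lam * t)) (convPow μ n)) φ)
  rw [average_dirac, average_convPow, average_apply, mul_apply_eq_comp] at h4
  rw [h4, smul_pow, smul_smul]
  simp only [ContinuousLinearMap.comp_apply, ContinuousLinearMap.apply_apply,
    map_smul]
  rw [RCLike.real_smul_eq_coe_smul (K := 𝕜)]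
  congr 1
  push_cast
  ring

end IsContractionSemigroup

/-- The scalar semigroup `t ↦ exp (-t x)`. -/
noncomputable def expSemigroup (x : ℝ) (t : ℝ≥0) : ℝ →L[ℝ] ℝ :=
  Real.exp (-(t * x)) • ContinuousLinearMap.id ℝ ℝ

theorem isContractionSemigroup_expSemigroup {x : ℝ} (hx : 0 ≤ x) :
    IsContractionSemigroup (expSemigroup x) where
  map_zero := by simp [expSemigroup]
  map_add s t := by
    ext
    simp [expSemigroup, ← Real.exp_add]
    ring
  tendsto_zero φ := by
    have : Continuous fun t : ℝ≥0 => expSemigroup x t φ := by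
      simp only [expSemigroup, smul_apply]
      fun_prop
    simpa [expSemigroup] using this.tendsto 0
  norm_le_one t := by
    refine ContinuousLinearMap.opNorm_le_bound _ zero_le_one fun y => ?_
    simp only [expSemigroup, smul_apply, norm_smul,
      ContinuousLinearMap.id_apply]
    gcongr
    rw [Real.norm_of_nonneg (Real.exp_pos _).le, Real.exp_le_one_iff]
    have : 0 ≤ (t : ℝ) * x := by positivity
    linarith

/-- A Laplace transform is an average of the scalar semigroup e^{-sx}, so this is
`average_compoundPoisson` in dimension one. -/
theorem integral_exp_compoundPoisson (σ lam : ℝ≥0) (μ : Measure ℝ≥0) [IsFiniteMeasure μ]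
    (t : ℝ≥0) {x : ℝ} (hx : 0 ≤ x) :
    ∫ s : ℝ≥0, Real.exp (-(s * x)) ∂(compoundPoisson σ lam μ t) =
      Real.exp (-(t * bernsteinFunction σ lam μ x)) := by
  have hT := isContractionSemigroup_expSemigroup hx
  have h1 := hT.average_compoundPoisson σ lam μ t (1 : ℝ)
  have h2 : hT.average μ =
      algebraMap ℝ (ℝ →L[ℝ] ℝ) (∫ s : ℝ≥0, Real.exp (-(s * x)) ∂μ) := by
    ext
    simp [hT.average_apply, expSemigroup, Algebra.algebraMap_eq_smul_one]
  rw [h2, hT.average_apply, ← algebraMap.coe_smul, ← NormedSpace.algebraMap_exp_comm] at h1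
  simp only [expSemigroup, smul_apply, ContinuousLinearMap.id_apply,
    smul_eq_mul, mul_one, Algebra.algebraMap_eq_smul_one, one_apply_eq_self,
    ← Real.exp_eq_exp_ℝ, ← Real.exp_add] at h1
  rw [h1, bernsteinFunction, integral_sub (integrable_const _) (integrable_exp_neg_mul μ hx),
    integral_const]
  simp
  ring

theorem IsConvolutionSemigroup.eq_compoundPoisson {η : ℝ≥0 → Measure ℝ≥0}
    (hη : IsConvolutionSemigroup η) {σ lam : ℝ≥0} {μ : Measure ℝ≥0} [IsFiniteMeasure μ]
    (hηf : HasLaplaceExponent η (bernsteinFunction σ lam μ)) (t : ℝ≥0) :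
    η t = compoundPoisson σ lam μ t := by
  have : IsFiniteMeasure (η t) := ⟨(hη.mass_le_one t).trans_lt ENNReal.one_lt_top⟩
  refine Measure.ext_of_integral_exp_neg_mul fun x hx => ?_
  rw [integral_exp_compoundPoisson σ lam μ t hx.le]
  rcases eq_or_ne t 0 with rfl | ht
  · simp [hη.zero]
  · exact hηf t (pos_iff_ne_zero.2 ht) x hx

end CompoundPoisson

section

variable {𝕜 X : Type*} [RCLike 𝕜] [NormedAddCommGroup X] [NormedSpace 𝕜 X]

/-! ### Operator exponentials, strong limits and measurability -/

section Exponential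

theorem NormedSpace.exp_add_of_commute_of_rclike (𝕜 : Type*) [RCLike 𝕜] {𝔸 : Type*}
    [NormedRing 𝔸] [NormedAlgebra 𝕜 𝔸] [CompleteSpace 𝔸] {x y : 𝔸} (h : Commute x y) :
    exp (x + y) = exp x * exp y :=
  let := NormedAlgebra.restrictScalars ℚ 𝕜 𝔸
  exp_add_of_commute h

variable {𝔸 : Type*} [NormedRing 𝔸] [NormedAlgebra 𝕜 𝔸] [CompleteSpace 𝔸]

theorem NormedSpace.exp_real_smul_add (C : 𝔸) (s t : ℝ) :
    exp (((s + t : ℝ) : 𝕜) • C) = exp ((s : 𝕜) • C) * exp ((t : 𝕜) • C) := by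
  rw [← exp_add_of_commute_of_rclike 𝕜 (((Commute.refl C).smul_left _).smul_right _), ← add_smul,
    RCLike.ofReal_add]

theorem NormedSpace.exp_real_smul_sub_algebraMap (B : 𝔸) (c t : ℝ) :
    exp ((t : 𝕜) • (B - algebraMap 𝕜 𝔸 c)) =
      ((Real.exp (-(c * t)) : ℝ) : 𝕜) • exp ((t : 𝕜) • B) := by
  have h1 : (t : 𝕜) • (B - algebraMap 𝕜 𝔸 c) =
      algebraMap 𝕜 𝔸 ((-(c * t) : ℝ) : 𝕜) + (t : 𝕜) • B := by
    rw [smul_sub, Algebra.algebraMap_eq_smul_one, Algebra.algebraMap_eq_smul_one, smul_smul]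
    push_cast
    rw [neg_smul, mul_comm (c : 𝕜)]
    abel
  rw [h1, exp_add_of_commute_of_rclike 𝕜 (Algebra.commute_algebraMap_left _ _),
    ← algebraMap_exp_comm, ← RCLike.algebraMap_eq_ofReal, ← algebraMap_exp_comm,
    ← Real.exp_eq_exp_ℝ, ← Algebra.smul_def]

theorem tendsto_exp_real_smul (C : 𝔸) :
    Tendsto (fun t : ℝ≥0 => NormedSpace.exp (((t : ℝ) : 𝕜) • C)) (𝓝 0) (𝓝 1) := by
  let := NormedAlgebra.restrictScalars ℚ 𝕜 𝔸
  have : Continuous fun t : ℝ≥0 => NormedSpace.exp (((t : ℝ) : 𝕜) • C) := by fun_prop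
  simpa using this.tendsto 0

theorem tendsto_inv_smul_exp_real_smul_sub_one (C : 𝔸) :
    Tendsto (fun t : ℝ≥0 => ((t : ℝ) : 𝕜)⁻¹ • (NormedSpace.exp (((t : ℝ) : 𝕜) • C) - 1))
      (𝓝[>] 0) (𝓝 C) := by
  have h1 := hasDerivAt_iff_tendsto_slope_zero.1 (hasDerivAt_exp_smul_const C (0 : 𝕜))
  have h2 : Tendsto (fun t : ℝ≥0 => ((t : ℝ) : 𝕜)) (𝓝[>] 0) (𝓝[≠] 0) := by
    refine tendsto_nhdsWithin_iff.2 ⟨?_, ?_⟩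
    · have : Continuous fun t : ℝ≥0 => ((t : ℝ) : 𝕜) := by fun_prop
      simpa using (this.tendsto 0).mono_left (nhdsWithin_le_nhds (s := Ioi 0))
    · filter_upwards [self_mem_nhdsWithin] with t ht
      have : t ≠ 0 := ne_of_gt ht
      simpa using this
  simpa [Function.comp_def] using h1.comp h2

end Exponential

theorem Filter.Tendsto.clm_apply_of_norm {ι : Type*} {l : Filter ι} {K : ι → X →L[𝕜] X}
    {v : ι → X} {L : X →L[𝕜] X} {φ : X} (hK : Tendsto K l (𝓝 L)) (hv : Tendsto v l (𝓝 φ)) :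
    Tendsto (fun i => K i (v i)) l (𝓝 (L φ)) :=
  (isBoundedBilinearMap_apply.continuous.tendsto (L, φ)).comp (hK.prodMk_nhds hv)

theorem tendsto_apply_of_norm_le_one {ι : Type*} {l : Filter ι} {K : ι → X →L[𝕜] X}
    (hK : ∀ i, ‖K i‖ ≤ 1) {v : ι → X} {φ y : X} (hv : Tendsto v l (𝓝 φ))
    (hφ : Tendsto (fun i => K i φ) l (𝓝 y)) : Tendsto (fun i => K i (v i)) l (𝓝 y) := by
  have h1 : Tendsto (fun i => K i (v i - φ)) l (𝓝 0) := by
    refine squeeze_zero_norm (fun i => ?_) (tendsto_iff_norm_sub_tendsto_zero.1 hv)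
    simpa using (K i).le_of_opNorm_le (hK i) (v i - φ)
  simpa using h1.add hφ

/-- K need not be measurable for the operator norm. Approximating g by simple functions reduces the
claim to orbits of fixed vectors. -/
theorem stronglyMeasurable_clm_apply {K : ℝ≥0 → X →L[𝕜] X}
    (hKm : ∀ φ : X, StronglyMeasurable fun t => K t φ) {g : ℝ≥0 → X}
    (hg : StronglyMeasurable g) : StronglyMeasurable fun t => K t (g t) := by
  have hsimple : ∀ f : SimpleFunc ℝ≥0 X, StronglyMeasurable fun t => K t (f t) := by
    intro f
    induction f using SimpleFunc.induction with
    | @const c s hs =>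
      convert (hKm c).indicator hs using 1
      ext t
      by_cases ht : t ∈ s <;> simp [ht]
    | add _ h1 h2 => simpa [Pi.add_def] using h1.add h2
  refine stronglyMeasurable_of_tendsto atTop (fun n => hsimple (hg.approx n)) ?_
  rw [tendsto_pi_nhds]
  intro t
  exact ((K t).continuous.tendsto _).comp (hg.tendsto_approx t)

theorem norm_pow_le_one_of_norm_le_one {f : X →L[𝕜] X} (hf : ‖f‖ ≤ 1) (n : ℕ) : ‖f ^ n‖ ≤ 1 := by
  induction n with
  | zero => exact ContinuousLinearMap.norm_id_le
  | succ n ih =>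
    rw [pow_succ]
    exact (norm_mul_le _ _).trans (mul_le_one₀ ih (norm_nonneg _) hf)

theorem stronglyMeasurable_pow_apply {K : ℝ≥0 → X →L[𝕜] X}
    (hKm : ∀ φ : X, StronglyMeasurable fun t => K t φ) (n : ℕ) (φ : X) :
    StronglyMeasurable fun t => (K t ^ n) φ := by
  induction n with
  | zero => simpa using stronglyMeasurable_const
  | succ n ih =>
    simp only [pow_succ', mul_apply_eq_comp]
    exact stronglyMeasurable_clm_apply hKm ih

/-! ### Graphs and cores -/

section Core

theorem LinearPMap.mem_graph_domRestrict_iff {A : X →ₗ.[𝕜] X} {D : Submodule 𝕜 X} {p : X × X} :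
    p ∈ (A.domRestrict D).graph ↔ p.1 ∈ D ∧ p ∈ A.graph := by
  constructor
  · intro hp
    obtain ⟨w, h1, h2⟩ := (mem_graph_iff _).1 hp
    exact ⟨h1 ▸ w.2.1, (mem_graph_iff _).2 ⟨⟨w, w.2.2⟩, h1, h2⟩⟩
  · rintro ⟨hD, hp⟩
    obtain ⟨w, h1, h2⟩ := (mem_graph_iff _).1 hp
    exact (mem_graph_iff _).2 ⟨⟨w, ⟨h1 ▸ hD, w.2⟩⟩, h1, h2⟩

theorem LinearPMap.IsClosed.hasCore {A : X →ₗ.[𝕜] X} (hA : A.IsClosed) {D : Submodule 𝕜 X}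
    (hD : D ≤ A.domain)
    (h : (A.graph : Set (X × X)) ⊆ _root_.closure ((A.domRestrict D).graph : Set (X × X))) :
    A.HasCore D where
  le_domain := hD
  closure_eq := by
    have hle : A.domRestrict D ≤ A := domRestrict_le
    have hc : (A.domRestrict D).IsClosable := hA.isClosable.leIsClosable hle
    refine eq_of_eq_graph (le_antisymm ?_ ?_)
    · rw [← hc.graph_closure_eq_closure_graph]
      exact Submodule.topologicalClosure_minimal _ (le_graph_of_le hle) hA
    · rw [← hc.graph_closure_eq_closure_graph]
      exact h

end Core

variable [NormedSpace ℝ X] [IsScalarTower ℝ 𝕜 X]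

omit [NormedSpace 𝕜 X] [IsScalarTower ℝ 𝕜 X] in
theorem tendsto_inv_smul_comp_mul {v : ℝ≥0 → X} {y : X} (hv0 : v 0 = 0)
    (hv : Tendsto (fun t : ℝ≥0 => (t : ℝ)⁻¹ • v t) (𝓝[>] 0) (𝓝 y)) (lam : ℝ≥0) :
    Tendsto (fun t : ℝ≥0 => (t : ℝ)⁻¹ • v (lam * t)) (𝓝[>] 0) (𝓝 ((lam : ℝ) • y)) := by
  rcases eq_or_ne lam 0 with rfl | hlam
  · simp [hv0]
  · have h1 : Tendsto (fun t : ℝ≥0 => lam * t) (𝓝[>] 0) (𝓝[>] 0) := by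
      refine tendsto_nhdsWithin_iff.2 ⟨?_, ?_⟩
      · have : Continuous fun t : ℝ≥0 => lam * t := by fun_prop
        simpa using (this.tendsto 0).mono_left (nhdsWithin_le_nhds (s := Ioi 0))
      · filter_upwards [self_mem_nhdsWithin] with t ht
        exact mul_pos (pos_iff_ne_zero.2 hlam) ht
    refine ((hv.comp h1).const_smul (lam : ℝ)).congr fun t => ?_
    have hlam' : (lam : ℝ) ≠ 0 := by exact_mod_cast hlam
    simp only [Function.comp_apply, smul_smul]
    congr 1
    push_cast
    field_simp

/-! ### Bounded commuting perturbation and the subordinate semigroup -/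

section Perturbation

variable [CompleteSpace X] {T : ℝ≥0 → X →L[𝕜] X} {C : X →L[𝕜] X} {lam : ℝ≥0}

/-- The semigroup generated by `lam L + C`, where `L` is the generator of `T` and `C` is a bounded
operator commuting with `T`. -/
noncomputable def perturbedSemigroup (T : ℝ≥0 → X →L[𝕜] X) (C : X →L[𝕜] X) (lam t : ℝ≥0) :
    X →L[𝕜] X :=
  NormedSpace.exp (((t : ℝ) : 𝕜) • C) * T (lam * t)

omit [NormedSpace ℝ X] [IsScalarTower ℝ 𝕜 X] in
theorem isStronglyContinuousSemigroup_perturbedSemigroup (hT : IsContractionSemigroup T)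
    (hC : ∀ t, Commute (T t) C) (lam : ℝ≥0) :
    IsStronglyContinuousSemigroup (perturbedSemigroup T C lam) where
  map_zero := by
    simp [perturbedSemigroup, hT.map_zero, ← ContinuousLinearMap.one_def]
  map_add s t := by
    change _ = perturbedSemigroup T C lam s * perturbedSemigroup T C lam t
    let := NormedAlgebra.restrictScalars ℚ 𝕜 (X →L[𝕜] X)
    have h1 : Commute (T (lam * s)) (NormedSpace.exp (((t : ℝ) : 𝕜) • C)) :=
      ((hC _).smul_right _).exp_right
    have h2 : T (lam * s + lam * t) = T (lam * s) * T (lam * t) := hT.map_add _ _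
    have h3 : NormedSpace.exp (((s + t : ℝ) : 𝕜) • C) =
        NormedSpace.exp (((s : ℝ) : 𝕜) • C) * NormedSpace.exp (((t : ℝ) : 𝕜) • C) :=
      NormedSpace.exp_real_smul_add C s t
    rw [perturbedSemigroup, perturbedSemigroup, perturbedSemigroup, NNReal.coe_add, h3, mul_add, h2, mul_assoc, mul_assoc, ← mul_assoc (T _), h1.eq,
      mul_assoc]
  tendsto_zero φ := by
    have h1 : Tendsto (fun t : ℝ≥0 => T (lam * t) φ) (𝓝 0) (𝓝 φ) := by
      have : Continuous fun t : ℝ≥0 => T (lam * t) φ :=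
        (hT.continuous_apply φ).comp (by fun_prop)
      simpa [hT.map_zero] using this.tendsto 0
    exact (tendsto_exp_real_smul (𝕜 := 𝕜) C).clm_apply_of_norm h1

theorem tendsto_inv_smul_exp_apply_sub (C : X →L[𝕜] X) (φ : X) :
    Tendsto (fun t : ℝ≥0 => (t : ℝ)⁻¹ • (NormedSpace.exp (((t : ℝ) : 𝕜) • C) φ - φ))
      (𝓝[>] 0) (𝓝 (C φ)) := by
  refine ((tendsto_inv_smul_exp_real_smul_sub_one (𝕜 := 𝕜) C).clm_apply_of_norm
    (tendsto_const_nhds (x := φ))).congr fun t => ?_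
  rw [RCLike.real_smul_eq_coe_smul (K := 𝕜)]
  simp

omit [IsScalarTower ℝ 𝕜 X] [CompleteSpace X] in
theorem perturbedSemigroup_apply_sub (hT : IsContractionSemigroup T) (t : ℝ≥0) (φ : X) :
    (t : ℝ)⁻¹ • (perturbedSemigroup T C lam t φ - perturbedSemigroup T C lam 0 φ) =
      NormedSpace.exp (((t : ℝ) : 𝕜) • C) ((t : ℝ)⁻¹ • (T (lam * t) φ - T 0 φ)) +
        (t : ℝ)⁻¹ • (NormedSpace.exp (((t : ℝ) : 𝕜) • C) φ - φ) := by
  have h1 : perturbedSemigroup T C lam 0 φ = φ := by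
    simp [perturbedSemigroup, hT.map_zero]
  have h2 : ∀ (L : X →L[𝕜] X) (r : ℝ) (v : X), L (r • v) = r • L v :=
    fun L r v => map_real_smul L.toLinearMap.toAddMonoidHom L.continuous _ _
  rw [h1, h2, ← smul_add, hT.map_zero, map_sub, perturbedSemigroup, mul_apply_eq_comp,
    ContinuousLinearMap.id_apply]
  congr 1
  abel

theorem HasDerivAtOrigin.perturbedSemigroup (hT : IsContractionSemigroup T) {φ y : X}
    (h : HasDerivAtOrigin T φ y) (C : X →L[𝕜] X) (lam : ℝ≥0) :
    HasDerivAtOrigin (perturbedSemigroup T C lam) φ ((lam : ℝ) • y + C φ) := by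
  have h1 := tendsto_inv_smul_comp_mul (v := fun t => T t φ - T 0 φ) (sub_self _) h lam
  have h2 := ((tendsto_exp_real_smul (𝕜 := 𝕜) C).mono_left
    (nhdsWithin_le_nhds (s := Ioi 0))).clm_apply_of_norm h1
  exact (h2.add (tendsto_inv_smul_exp_apply_sub C φ)).congr fun t =>
    (perturbedSemigroup_apply_sub hT t φ).symm

theorem hasDerivAtOrigin_perturbedSemigroup_zero (hT : IsContractionSemigroup T)
    (C : X →L[𝕜] X) (φ : X) : HasDerivAtOrigin (perturbedSemigroup T C 0) φ (C φ) := by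
  refine (tendsto_inv_smul_exp_apply_sub C φ).congr fun t => ?_
  rw [perturbedSemigroup_apply_sub hT]
  simp

/-- Multiplying by exp(-tC) removes the exponential factor, and rescaling time by λ⁻¹ recovers T.
For λ = 0 no information on T survives. -/
theorem HasDerivAtOrigin.of_perturbedSemigroup (hT : IsContractionSemigroup T) {φ z : X}
    (hlam : lam ≠ 0) (h : HasDerivAtOrigin (_root_.perturbedSemigroup T C lam) φ z) :
    HasDerivAtOrigin T φ ((lam : ℝ)⁻¹ • (z - C φ)) := by
  have h1 := h.sub (tendsto_inv_smul_exp_apply_sub C φ)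
  have h2 := ((tendsto_exp_real_smul (𝕜 := 𝕜) (-C)).mono_left
    (nhdsWithin_le_nhds (s := Ioi 0))).clm_apply_of_norm h1
  have h3 : Tendsto (fun t : ℝ≥0 => (t : ℝ)⁻¹ • (T (lam * t) φ - T 0 φ)) (𝓝[>] 0)
      (𝓝 (z - C φ)) := by
    refine h2.congr fun t => ?_
    rw [perturbedSemigroup_apply_sub hT, add_sub_cancel_right, ← mul_apply_eq_comp,
      ← NormedSpace.exp_add_of_commute_of_rclike 𝕜]
    · simp
    · exact ((Commute.refl C).neg_left.smul_left _).smul_right _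
  have h4 := tendsto_inv_smul_comp_mul (v := fun t => T (lam * t) φ - T 0 φ) (by simp) h3 lam⁻¹
  rw [NNReal.coe_inv] at h4
  refine h4.congr fun t => ?_
  rw [mul_inv_cancel_left₀ hlam]

theorem LinearPMap.HasCore.perturbedSemigroup (hT : IsContractionSemigroup T)
    (hS : IsContractionSemigroup (perturbedSemigroup T C lam)) {D : Submodule 𝕜 X}
    (hD : (semigroupGenerator T).HasCore D) :
    (semigroupGenerator (_root_.perturbedSemigroup T C lam)).HasCore D := by
  have hdom : ∀ φ ∈ D, ∃ y, HasDerivAtOrigin T φ y := fun φ hφ => hD.le_domain hφ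
  refine LinearPMap.IsClosed.hasCore ?_ (fun φ hφ => ?_) ?_
  · have h1 := hS.isClosed_hasDerivAtOrigin
    have h2 : ((semigroupGenerator (_root_.perturbedSemigroup T C lam)).graph : Set (X × X)) =
        {q : X × X | HasDerivAtOrigin (_root_.perturbedSemigroup T C lam) q.1 q.2} := by
      ext ⟨φ, y⟩
      exact mem_graph_semigroupGenerator
    rwa [← h2] at h1
  · obtain ⟨y, hy⟩ := hdom φ hφ
    exact ⟨_, hy.perturbedSemigroup hT C lam⟩
  · rintro ⟨φ, z⟩ hz
    have hz' : HasDerivAtOrigin (_root_.perturbedSemigroup T C lam) φ z :=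
      mem_graph_semigroupGenerator.1 hz
    rcases eq_or_ne lam 0 with rfl | hlam
    -- For λ = 0 the generator is the bounded operator C, so any dense subspace is a core. D is
    -- dense because its closure contains the dense domain of L.
    · have hDd : Dense (D : Set X) := by
        rw [← dense_closure]
        refine hT.dense_setOf_hasDerivAtOrigin.mono ?_
        rintro ψ ⟨y, hy⟩
        have h1 := image_closure_subset_closure_image continuous_fst
          (mem_image_of_mem Prod.fst
            (hD.graph_subset_closure (mem_graph_semigroupGenerator.2 hy)))
        refine closure_mono ?_ h1
        rintro _ ⟨p, hp, rfl⟩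
        exact (mem_graph_domRestrict_iff.1 hp).1
      obtain rfl := hz'.unique (hasDerivAtOrigin_perturbedSemigroup_zero hT C φ)
      have hc : Continuous fun ψ : X => (ψ, C ψ) := by fun_prop
      refine closure_mono ?_ (image_closure_subset_closure_image hc
        (mem_image_of_mem _ (hDd φ)))
      rintro _ ⟨ψ, hψ, rfl⟩
      exact mem_graph_domRestrict_iff.2 ⟨hψ, mem_graph_semigroupGenerator.2
        (hasDerivAtOrigin_perturbedSemigroup_zero hT C ψ)⟩
    -- For λ ≠ 0 the continuous map (φ, y) ↦ (φ, λ y + C φ) carries the graph of L onto that of the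
    -- new generator, and carries the part over D to the part over D.
    · have hy := hz'.of_perturbedSemigroup hT hlam
      have hc : Continuous fun p : X × X => (p.1, (lam : ℝ) • p.2 + C p.1) := by fun_prop
      have h1 := image_closure_subset_closure_image hc (mem_image_of_mem _
        (hD.graph_subset_closure (mem_graph_semigroupGenerator.2 hy)))
      have hlam' : (lam : ℝ) ≠ 0 := by exact_mod_cast hlam
      simp only [smul_inv_smul₀ hlam', sub_add_cancel] at h1
      refine closure_mono ?_ h1
      rintro _ ⟨p, hp, rfl⟩
      obtain ⟨hp1, hp2⟩ := mem_graph_domRestrict_iff.1 hp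
      exact mem_graph_domRestrict_iff.2 ⟨hp1, mem_graph_semigroupGenerator.2
        ((mem_graph_semigroupGenerator.1 hp2).perturbedSemigroup hT C lam)⟩

/-- The bounded part of the generator of the subordinate semigroup. -/
noncomputable def IsContractionSemigroup.jumpGenerator (hT : IsContractionSemigroup T) (σ : ℝ≥0)
    (μ : Measure ℝ≥0) [IsFiniteMeasure μ] : X →L[𝕜] X :=
  hT.average μ - algebraMap 𝕜 (X →L[𝕜] X) ((σ + μ.real univ : ℝ) : 𝕜)

theorem IsContractionSemigroup.commute_jumpGenerator (hT : IsContractionSemigroup T) (σ : ℝ≥0)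
    (μ : Measure ℝ≥0) [IsFiniteMeasure μ] (t : ℝ≥0) : Commute (T t) (hT.jumpGenerator σ μ) :=
  (hT.commute_average μ t).sub_right (Algebra.commute_algebraMap_right _ _)

/-- Both sides are e^{-(σ+|μ|)t} exp(t ∫ T_s μ(ds)) T_{λt}. The left form exposes the semigroup law
and the generator, the right form the integral representation and the norm bound. -/
theorem IsContractionSemigroup.perturbedSemigroup_jumpGenerator (hT : IsContractionSemigroup T)
    (σ lam : ℝ≥0) (μ : Measure ℝ≥0) [IsFiniteMeasure μ] (t : ℝ≥0) :
    perturbedSemigroup T (hT.jumpGenerator σ μ) lam t =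
      hT.average (compoundPoisson σ lam μ t) := by
  ext φ
  let := NormedAlgebra.restrictScalars ℚ 𝕜 (X →L[𝕜] X)
  have h1 : Commute (T (lam * t)) (NormedSpace.exp (((t : ℝ) : 𝕜) • hT.average μ)) :=
    ((hT.commute_average μ _).smul_right _).exp_right
  rw [average_compoundPoisson, perturbedSemigroup, jumpGenerator,
    NormedSpace.exp_real_smul_sub_algebraMap, smul_mul_assoc, ← h1.eq,
    RCLike.real_smul_eq_coe_smul (K := 𝕜)]
  rfl

end Perturbation

/-! ### The approximating family and its derivative at the origin -/

section LevyFamily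

variable {F : ℝ≥0 → X →L[𝕜] X}

/-- The operator `φ ↦ ∫ F(s / n)^n φ μ(ds)`. -/
noncomputable def iterateAverage (hF : ∀ t, ‖F t‖ ≤ 1)
    (hFm : ∀ φ : X, StronglyMeasurable fun t => F t φ) (μ : Measure ℝ≥0) [IsFiniteMeasure μ]
    (n : ℕ) : X →L[𝕜] X :=
  averageOperator (K := fun s => F (s / (n : ℝ≥0)) ^ n)
    (fun _ => norm_pow_le_one_of_norm_le_one (hF _) n)
    (fun φ => (stronglyMeasurable_pow_apply hFm n φ).comp_measurable
      (measurable_id.div_const _)) μ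

/-- The operator family `e^{-σ t} F(lam t) (φ + t ∫ (F(s / m t)^(m t) φ - φ) μ(ds))`. -/
noncomputable def levyFamily (hF : ∀ t, ‖F t‖ ≤ 1)
    (hFm : ∀ φ : X, StronglyMeasurable fun t => F t φ) (σ lam : ℝ≥0) (μ : Measure ℝ≥0)
    [IsFiniteMeasure μ] (m : ℝ≥0 → ℕ) (t : ℝ≥0) : X →L[𝕜] X :=
  ((Real.exp (-(σ * t : ℝ)) : ℝ) : 𝕜) • (F (lam * t) * (1 + ((t : ℝ) : 𝕜) •
    (iterateAverage hF hFm μ (m t) - ((μ.real univ : ℝ) : 𝕜) • (1 : X →L[𝕜] X))))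

theorem levyFamily_apply (hF : ∀ t, ‖F t‖ ≤ 1)
    (hFm : ∀ φ : X, StronglyMeasurable fun t => F t φ) (σ lam : ℝ≥0) (μ : Measure ℝ≥0)
    [IsFiniteMeasure μ] (m : ℝ≥0 → ℕ) (t : ℝ≥0) (φ : X) :
    levyFamily hF hFm σ lam μ m t φ = Real.exp (-(σ * t : ℝ)) • F (lam * t)
      (φ + (t : ℝ) • (iterateAverage hF hFm μ (m t) φ - μ.real univ • φ)) := by
  simp only [RCLike.real_smul_eq_coe_smul (K := 𝕜)]
  rfl

omit [NormedSpace ℝ X] [IsScalarTower ℝ 𝕜 X] in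
theorem integrable_iterate_apply (hF : ∀ t, ‖F t‖ ≤ 1)
    (hFm : ∀ φ : X, StronglyMeasurable fun t => F t φ) (μ : Measure ℝ≥0)
    [IsFiniteMeasure μ] (n : ℕ) (φ : X) :
    Integrable (fun s : ℝ≥0 => (F (s / (n : ℝ≥0)) ^ n) φ) μ :=
  integrable_apply_of_norm_le_one (K := fun s => F (s / (n : ℝ≥0)) ^ n)
    (fun _ => norm_pow_le_one_of_norm_le_one (hF _) n)
    (fun φ => (stronglyMeasurable_pow_apply hFm n φ).comp_measurable
      (measurable_id.div_const _)) μ φ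

theorem isLevyFamily_levyFamily [CompleteSpace X] (hF : ∀ t, ‖F t‖ ≤ 1)
    (hFm : ∀ φ : X, StronglyMeasurable fun t => F t φ) (σ lam : ℝ≥0) (μ : Measure ℝ≥0)
    [IsFiniteMeasure μ] (m : ℝ≥0 → ℕ) :
    IsLevyFamily F σ lam μ m (levyFamily hF hFm σ lam μ m) := by
  intro t φ
  have h1 := integrable_iterate_apply hF hFm μ (m t) φ
  refine ⟨h1.sub (integrable_const _), ?_⟩
  rw [levyFamily_apply, integral_sub h1 (integrable_const _), integral_const]
  rfl

theorem norm_levyFamily_le (hF : ∀ t, ‖F t‖ ≤ 1)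
    (hFm : ∀ φ : X, StronglyMeasurable fun t => F t φ) (σ lam : ℝ≥0) (μ : Measure ℝ≥0)
    [IsFiniteMeasure μ] (m : ℝ≥0 → ℕ) (t : ℝ≥0) :
    ‖levyFamily hF hFm σ lam μ m t‖ ≤ Real.exp (2 * μ.real univ * t) := by
  have hμ : 0 ≤ μ.real univ := measureReal_nonneg
  have h1 : ‖((Real.exp (-(σ * t : ℝ)) : ℝ) : 𝕜)‖ ≤ 1 := by
    rw [RCLike.norm_ofReal, abs_of_pos (Real.exp_pos _), Real.exp_le_one_iff]
    have : 0 ≤ (σ : ℝ) * t := by positivity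
    linarith
  have hone : ‖(1 : X →L[𝕜] X)‖ ≤ 1 := ContinuousLinearMap.norm_id_le
  have h2 : ‖iterateAverage hF hFm μ (m t) - ((μ.real univ : ℝ) : 𝕜) • (1 : X →L[𝕜] X)‖ ≤
      2 * μ.real univ := by
    refine (norm_sub_le _ _).trans ?_
    have h3 : ‖iterateAverage hF hFm μ (m t)‖ ≤ μ.real univ := norm_averageOperator_le _ _ _
    have h4 : ‖((μ.real univ : ℝ) : 𝕜) • (1 : X →L[𝕜] X)‖ ≤ μ.real univ := by
      rw [norm_smul, RCLike.norm_ofReal, abs_of_nonneg hμ]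
      exact mul_le_of_le_one_right hμ hone
    linarith
  have h5 : ‖1 + ((t : ℝ) : 𝕜) • (iterateAverage hF hFm μ (m t) -
      ((μ.real univ : ℝ) : 𝕜) • (1 : X →L[𝕜] X))‖ ≤ Real.exp (2 * μ.real univ * t) := by
    refine (norm_add_le _ _).trans ?_
    rw [norm_smul, RCLike.norm_ofReal, abs_of_nonneg t.coe_nonneg]
    have h6 : (t : ℝ) * ‖iterateAverage hF hFm μ (m t) -
        ((μ.real univ : ℝ) : 𝕜) • (1 : X →L[𝕜] X)‖ ≤ t * (2 * μ.real univ) := by gcongr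
    have h7 := Real.add_one_le_exp (2 * μ.real univ * t)
    linarith
  calc ‖levyFamily hF hFm σ lam μ m t‖
      ≤ 1 * (1 * Real.exp (2 * μ.real univ * t)) := by
        rw [levyFamily, norm_smul]
        gcongr
        refine (norm_mul_le _ _).trans ?_
        gcongr
        exact hF _
    _ = _ := by rw [one_mul, one_mul]

variable [CompleteSpace X] {T : ℝ≥0 → X →L[𝕜] X}

/-- Chernoff's estimate with the single step n = 1 compares F(t)φ with T_t φ for every φ, not only
on the core. -/
theorem ChernoffEquivalent.tendsto_zero (hT : IsContractionSemigroup T)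
    (hFT : ChernoffEquivalent F T) (φ : X) : Tendsto (fun t => F t φ) (𝓝 0) (𝓝 φ) := by
  rw [Metric.tendsto_nhds]
  intro ε hε
  have h1 := hFT.eventually_norm_pow_sub_le hT φ 1 (half_pos hε)
  rw [eventually_nhdsWithin_iff] at h1
  filter_upwards [h1, Metric.tendsto_nhds.1 (hT.tendsto_zero φ) _ (half_pos hε),
    Iic_mem_nhds (zero_lt_one' ℝ≥0)] with t ht1 ht2 ht3
  rcases eq_or_ne t 0 with rfl | ht
  · simpa [hFT.1] using hε
  · have h2 := ht1 (pos_iff_ne_zero.2 ht) 1 (by simpa using ht3)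
    simp only [pow_one, Nat.cast_one, one_mul, ← dist_eq_norm] at h2
    linarith [dist_triangle (F t φ) (T t φ) φ]

/-- Chernoff's theorem for F gives F(s/n)^n φ → T_s φ for each s; contractivity gives the dominating
constant ‖φ‖. -/
theorem ChernoffEquivalent.tendsto_iterateAverage (hT : IsContractionSemigroup T)
    (hFT : ChernoffEquivalent F T) (hF : ∀ t, ‖F t‖ ≤ 1)
    (hFm : ∀ φ : X, StronglyMeasurable fun t => F t φ) (μ : Measure ℝ≥0) [IsFiniteMeasure μ]
    (φ : X) : Tendsto (fun n => iterateAverage hF hFm μ n φ) atTop (𝓝 (hT.average μ φ)) := by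
  refine tendsto_integral_of_dominated_convergence (fun _ => ‖φ‖)
    (fun n => (integrable_iterate_apply hF hFm μ n φ).aestronglyMeasurable) (integrable_const _)
    (fun n => Eventually.of_forall fun s => ?_) (Eventually.of_forall fun s => ?_)
  · simpa using (F (s / (n : ℝ≥0)) ^ n).le_of_opNorm_le
      (norm_pow_le_one_of_norm_le_one (hF _) n) φ
  · have h1 := hFT.tendstoLocallyUniformly hT φ
    exact (tendstoLocallyUniformlyOn_univ.2 h1).tendsto_at (mem_univ s)

omit [NormedSpace 𝕜 X] [IsScalarTower ℝ 𝕜 X] [CompleteSpace X] in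
theorem tendsto_inv_smul_exp_neg_mul_sub_one_smul (σ : ℝ) (φ : X) :
    Tendsto (fun t : ℝ≥0 => ((t : ℝ)⁻¹ * (Real.exp (-(σ * t)) - 1)) • φ) (𝓝[>] 0)
      (𝓝 (-σ • φ)) := by
  have h1 := tendsto_inv_smul_exp_real_smul_sub_one (𝕜 := ℝ) (-σ)
  refine Tendsto.smul_const (h1.congr fun t => ?_) φ
  rw [← Real.exp_eq_exp_ℝ]
  simp [mul_comm]

/-- This is a product rule. With B_t the integral part, the quotient equals e^{-σt} (F(λt) B_t φ +
t⁻¹ (F(λt)φ - φ)) + t⁻¹ (e^{-σt} - 1) φ. Since the F(λt) are contractions converging strongly to the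
identity, F(λt) B_t φ has the limit of B_t φ. -/
theorem tendsto_inv_smul_levyFamily_sub (hT : IsContractionSemigroup T)
    (hFT : ChernoffEquivalent F T) (hF : ∀ t, ‖F t‖ ≤ 1)
    (hFm : ∀ φ : X, StronglyMeasurable fun t => F t φ) (σ lam : ℝ≥0) (μ : Measure ℝ≥0)
    [IsFiniteMeasure μ] {m : ℝ≥0 → ℕ} (hm : Tendsto m (𝓝[>] 0) atTop) {φ y : X}
    (hφ : Tendsto (fun t : ℝ≥0 => (t : ℝ)⁻¹ • (F t φ - φ)) (𝓝[>] 0) (𝓝 y)) :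
    Tendsto (fun t : ℝ≥0 => (t : ℝ)⁻¹ • (levyFamily hF hFm σ lam μ m t φ - φ)) (𝓝[>] 0)
      (𝓝 ((lam : ℝ) • y + hT.jumpGenerator σ μ φ)) := by
  have hB : Tendsto (fun t => iterateAverage hF hFm μ (m t) φ - μ.real univ • φ) (𝓝[>] 0)
      (𝓝 (hT.average μ φ - μ.real univ • φ)) :=
    ((hFT.tendsto_iterateAverage hT hF hFm μ φ).comp hm).sub_const _
  have hlam : Tendsto (fun t : ℝ≥0 => lam * t) (𝓝[>] 0) (𝓝 0) := by
    have : Continuous fun t : ℝ≥0 => lam * t := by fun_prop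
    simpa using (this.tendsto 0).mono_left (nhdsWithin_le_nhds (s := Ioi 0))
  have hFB := tendsto_apply_of_norm_le_one (fun t => hF (lam * t)) hB
    ((hFT.tendsto_zero hT _).comp hlam)
  have hFφ := tendsto_inv_smul_comp_mul (v := fun t => F t φ - φ) (by simp [hFT.1]) hφ lam
  have hexp : Tendsto (fun t : ℝ≥0 => Real.exp (-(σ * t : ℝ))) (𝓝[>] 0) (𝓝 1) := by
    have : Continuous fun t : ℝ≥0 => Real.exp (-(σ * t : ℝ)) := by fun_prop
    simpa using (this.tendsto 0).mono_left (nhdsWithin_le_nhds (s := Ioi 0))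
  have hlim : (1 : ℝ) • (hT.average μ φ - μ.real univ • φ + (lam : ℝ) • y) + -(σ : ℝ) • φ =
      (lam : ℝ) • y + hT.jumpGenerator σ μ φ := by
    have : hT.jumpGenerator σ μ φ = hT.average μ φ - ((σ : ℝ) + μ.real univ) • φ := by
      rw [RCLike.real_smul_eq_coe_smul (K := 𝕜), IsContractionSemigroup.jumpGenerator,
        Algebra.algebraMap_eq_smul_one]
      rfl
    rw [this, one_smul, add_smul, neg_smul]
    abel
  rw [← hlim]
  refine ((hexp.smul (hFB.add hFφ)).add
    (tendsto_inv_smul_exp_neg_mul_sub_one_smul (σ : ℝ) φ)).congr' ?_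
  filter_upwards [self_mem_nhdsWithin] with t ht
  have ht0 : (t : ℝ) ≠ 0 := by exact_mod_cast (ne_of_gt ht)
  have h2 : ∀ (L : X →L[𝕜] X) (r : ℝ) (v : X), L (r • v) = r • L v :=
    fun L r v => map_real_smul L.toLinearMap.toAddMonoidHom L.continuous _ _
  rw [levyFamily_apply, map_add, h2, mul_smul, sub_smul, one_smul]
  simp only [smul_add, smul_sub, smul_comm (Real.exp _) (t : ℝ)⁻¹,
    smul_comm (Real.exp _) (t : ℝ), inv_smul_smul₀ ht0]
  abel

theorem chernoffEquivalent_levyFamily (hT : IsContractionSemigroup T)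
    (hFT : ChernoffEquivalent F T) (hF : ∀ t, ‖F t‖ ≤ 1)
    (hFm : ∀ φ : X, StronglyMeasurable fun t => F t φ) (σ lam : ℝ≥0) (μ : Measure ℝ≥0)
    [IsFiniteMeasure μ] {m : ℝ≥0 → ℕ} (hm : Tendsto m (𝓝[>] 0) atTop)
    (hS : IsContractionSemigroup (perturbedSemigroup T (hT.jumpGenerator σ μ) lam)) :
    ChernoffEquivalent (levyFamily hF hFm σ lam μ m)
      (perturbedSemigroup T (hT.jumpGenerator σ μ) lam) := by
  refine ⟨?_, ⟨2 * μ.real univ, by positivity, norm_levyFamily_le hF hFm σ lam μ m⟩, ?_⟩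
  · ext φ
    simp [levyFamily_apply, hFT.1]
  · obtain ⟨D, hD, h⟩ := hFT.2.2
    refine ⟨D, hD.perturbedSemigroup hT hS, fun φ hφ => ?_⟩
    have h1 := tendsto_inv_smul_levyFamily_sub hT hFT hF hFm σ lam μ hm (h φ hφ)
    have h2 := (semigroupGenerator_apply_eq_iff T ⟨φ, hD.le_domain hφ⟩ _).1 rfl
    have h3 := (semigroupGenerator_apply_eq_iff (perturbedSemigroup T (hT.jumpGenerator σ μ) lam)
      ⟨φ, (hD.perturbedSemigroup hT hS).le_domain hφ⟩ _).2 (h2.perturbedSemigroup hT _ lam)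
    rw [h3]
    exact h1

end LevyFamily

end

/-! ### Subordination and the product formula -/

theorem mainTheorem2
    {𝕜 X : Type*} [RCLike 𝕜] [NormedAddCommGroup X] [NormedSpace 𝕜 X] [NormedSpace ℝ X]
    [IsScalarTower ℝ 𝕜 X] [CompleteSpace X]
    (T : ℝ≥0 → X →L[𝕜] X) (hT : IsContractionSemigroup T)
    (F : ℝ≥0 → X →L[𝕜] X) (hF_norm : ∀ t, ‖F t‖ ≤ 1)
    (hF_meas : ∀ φ : X, StronglyMeasurable (fun t => F t φ))
    (hF : ChernoffEquivalent F T)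
    (σ lam : ℝ≥0) (μ : Measure ℝ≥0) (hμ_zero : μ {0} = 0) [IsFiniteMeasure μ]
    (η : ℝ≥0 → Measure ℝ≥0) (hη : IsConvolutionSemigroup η)
    (hηf : HasLaplaceExponent η (bernsteinFunction σ lam μ))
    (m : ℝ≥0 → ℕ) (hm_anti : AntitoneOn m (Ioi 0)) (hm : Tendsto m (𝓝[>] 0) atTop) :
    ∃ Tf Fμ : ℝ≥0 → X →L[𝕜] X,
      IsSubordinate T η Tf ∧ IsContractionSemigroup Tf ∧
      IsLevyFamily F σ lam μ m Fμ ∧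
      ChernoffEquivalent Fμ Tf ∧
      ∀ φ : X, TendstoLocallyUniformly
        (fun (n : ℕ) (t : ℝ≥0) => (Fμ (t / (n : ℝ≥0)) ^ n) φ) (fun t => Tf t φ) atTop := by
  have hη' := hη.eq_compoundPoisson hηf
  have hS : IsContractionSemigroup (perturbedSemigroup T (hT.jumpGenerator σ μ) lam) :=
    { isStronglyContinuousSemigroup_perturbedSemigroup hT (hT.commute_jumpGenerator σ μ) lam with
      norm_le_one := fun t => by
        -- Contractivity is read off the averaged form: the norm is at most the mass of η_t.
        rw [hT.perturbedSemigroup_jumpGenerator]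
        refine (norm_averageOperator_le _ _ _).trans ?_
        have h1 := hη.mass_le_one t
        rw [hη' t] at h1
        exact ENNReal.toReal_le_of_le_ofReal zero_le_one (by simpa using h1) }
  have hchern := chernoffEquivalent_levyFamily hT hF hF_norm hF_meas σ lam μ hm hS
  refine ⟨_, _, fun t φ => ?_, hS, isLevyFamily_levyFamily hF_norm hF_meas σ lam μ m, hchern,
    fun φ => hchern.tendstoLocallyUniformly hS φ⟩
  rw [hη' t, hT.perturbedSemigroup_jumpGenerator]
  exact ⟨hT.integrable_apply _ φ, rfl⟩
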